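/- Let $X$ be a finite CAT(0) cube complex, that is, a cube complex with finitely many cubes (cubes are embedded, faces of cubes are cubes, and two cubes are disjoint or meet in a common face) which is simply connected (in particular connected and non-empty) and in which the link of every vertex is a flag complex. A midplane of a cube $[-\frac12,\frac12]^q$ is its intersection with a coordinate hyperplane of $\mathbb R^q$. Two midplanes of cubes of $X$ are equivalent if they are the first and last members of a finite sequence of midplanes in which any two consecutive ones intersect in a midplane. A hyperplane is the union of all midplanes in an equivalence class; it cuts a cube if it contains a midplane of that cube. Two cubes $D_1, D_2$ of $X$ are parallel if they have the same dimension and every hyperplane that cuts $D_1$ also cuts $D_2$. A normal cube path from a vertex $Q$ to a vertex $P$ is a finite sequence $C_0,\dots,C_k$ of cubes of positive dimension, together with vertices $Q=v_0,v_1,\dots,v_{k+1}=P$, such that $v_i$ and $v_{i+1}$ are diagonally opposite in $C_i$ for every $i$, and for $0\le i<k$ the cube $C_{i+1}$ meets the union of all cubes having $C_i$ as a face only in the vertex $v_{i+1}$. The empty sequence is also allowed, as a path from $Q$ to itself; its first cube is by convention the $0$-cube $Q$. Then parallelism is an equivalence relation on the cubes of $X$, and the number of vertices of $X$ is equal to the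 number of parallelism classes of cubes of all dimensions. Moreover, for every vertex $P$ of $X$: for each vertex $Q$ there is exactly one normal cube path from $Q$ to $P$, and the map which sends $Q$ to the parallelism class of the first cube of the normal cube path from $Q$ to $P$ is a bijection from the set of vertices of $X$ onto the set of parallelism classes of cubes of $X$. -/

import Mathlib

/-- The face of the combinatorial cube `{0,1}^n` obtained by fixing the coordinates in `s`
to the values prescribed by `a`. -/
def stdFace {n : ℕ} (s : Finset (Fin n)) (a : Fin n → Bool) : Set (Fin n → Bool) :=
  {ε | ∀ i ∈ s, ε i = a i}

/-- `φ` identifies the vertices of the `n`-cube bijectively with `C`, in such a way that the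
members of `cubes` contained in `C` are exactly the faces of the `n`-cube. -/
def IsCubeChart {V : Type*} (cubes : Set (Set V)) {n : ℕ} (φ : (Fin n → Bool) → V)
    (C : Set V) : Prop :=
  Function.Injective φ ∧ Set.range φ = C ∧
    ∀ F ⊆ C, F ∈ cubes ↔ ∃ (s : Finset (Fin n)) (a : Fin n → Bool), F = φ '' stdFace s a

/-- A cube complex with vertex set `V`, whose cubes are embedded and meet along common faces;
each cube is recorded by its set of vertices. -/
structure CubeComplex (V : Type*) where
  /-- The vertex sets of the cubes, of all dimensions. -/
  cubes : Set (Set V)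
  /-- Every element of `V` is a vertex of the complex. -/
  singleton_mem : ∀ v : V, {v} ∈ cubes
  /-- Every cube is a combinatorial cube, and its faces are cubes of the complex. -/
  exists_chart : ∀ C ∈ cubes, ∃ (n : ℕ) (φ : (Fin n → Bool) → V), IsCubeChart cubes φ C
  /-- Two cubes are disjoint or meet in a common face. -/
  inter_mem : ∀ C ∈ cubes, ∀ D ∈ cubes, (C ∩ D).Nonempty → C ∩ D ∈ cubes

/-- The point with coordinates `t ∈ [0,1]^n` of a cube with chart `φ`, given by its multilinear
weights: the vertex `φ ε` has weight `∏ i, (t i or 1 - t i)`, according to whether `ε i` is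
`1` or `0`. This embeds the cube `[0,1]^n` in `V → ℝ`, compatibly with passing to faces. -/
noncomputable def cubePoint {V : Type*} {n : ℕ} (φ : (Fin n → Bool) → V) (t : Fin n → ℝ) :
    V → ℝ :=
  fun v => ∑ ε : Fin n → Bool,
    Set.indicator {φ ε} (fun _ => ∏ i, if ε i = true then t i else 1 - t i) v

namespace CubeComplex

variable {V : Type*} (X : CubeComplex V)

/-- The type of cubes of the complex, of all dimensions. -/
def Cube : Type _ := {C : Set V // C ∈ X.cubes}

/-- A vertex, viewed as a cube of dimension `0`. -/
def vertexCube (v : V) : X.Cube := ⟨{v}, X.singleton_mem v⟩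

/-- The cube `C` has dimension `n`. -/
def HasDim (C : X.Cube) (n : ℕ) : Prop :=
  ∃ φ : (Fin n → Bool) → V, IsCubeChart X.cubes φ C.1

/-- The geometric realization of a cube complex with finitely many vertices: a union of
copies of `[0,1]^n`, one for each cube, glued along common faces; its topology is the subspace
topology from `V → ℝ`. -/
def realization : Set (V → ℝ) :=
  {p | ∃ (C : X.Cube) (n : ℕ) (φ : (Fin n → Bool) → V) (t : Fin n → ℝ),
    IsCubeChart X.cubes φ C.1 ∧ (∀ i, t i ∈ Set.Icc (0 : ℝ) 1) ∧ p = cubePoint φ t}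

/-- Two vertices are joined by an edge. -/
def Adj (v w : V) : Prop := v ≠ w ∧ {v, w} ∈ X.cubes

/-- The simplices of the link of `v`: its vertices are the neighbours of `v` (one for each edge
at `v`), and each cube containing `v` gives the simplex of the neighbours of `v` in it.
The vertex `v` itself gives the empty simplex. -/
def IsLinkSimplex (v : V) (S : Set V) : Prop :=
  ∃ C ∈ X.cubes, v ∈ C ∧ S = {w | w ∈ C ∧ X.Adj v w}

/-- The link of `v` is a flag complex: finitely many pairwise adjacent vertices of the link
span a simplex of the link. -/
def IsFlagLink (v : V) : Prop :=
  ∀ S : Set V, S.Finite → (∀ w ∈ S, X.Adj v w) →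
    (∀ w ∈ S, ∀ w' ∈ S, w ≠ w' → X.IsLinkSimplex v {w, w'}) → X.IsLinkSimplex v S

/-- A finite cube complex is CAT(0) if it is simply connected (in particular connected and
nonempty) and the link of every vertex is a flag complex. -/
structure IsCAT0 [Finite V] : Prop where
  simplyConnected : SimplyConnectedSpace X.realization
  flag : ∀ v : V, X.IsFlagLink v

/-- `M` is a midplane of the cube `C`: the midplane perpendicular to the `i`-th coordinate is
recorded by the set of edges of `C` that it crosses. Two midplanes meet in a midplane if and
only if the set of edges that they both cross is that of a midplane. -/
def IsMidplaneOf (M : Set (Sym2 V)) (C : X.Cube) : Prop :=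
  ∃ (n : ℕ) (φ : (Fin n → Bool) → V), IsCubeChart X.cubes φ C.1 ∧
    ∃ i : Fin n, M = Set.range fun ε => s(φ ε, φ (Function.update ε i (!ε i)))

/-- `M` is a midplane of some cube of the complex. -/
def IsMidplane (M : Set (Sym2 V)) : Prop := ∃ C : X.Cube, X.IsMidplaneOf M C

/-- Hyperplane equivalence: two midplanes are the first and last members of a finite sequence
of midplanes in which any two consecutive ones intersect in a midplane. -/
def MidplaneEquiv : Set (Sym2 V) → Set (Sym2 V) → Prop :=
  Relation.ReflTransGen fun M N => X.IsMidplane M ∧ X.IsMidplane N ∧ X.IsMidplane (M ∩ N)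

/-- A hyperplane is the union of all midplanes in an equivalence class of midplanes. -/
def IsHyperplane (H : Set (Sym2 V)) : Prop :=
  ∃ M, X.IsMidplane M ∧ H = ⋃₀ {N | X.IsMidplane N ∧ X.MidplaneEquiv M N}

/-- The hyperplane `H` cuts the cube `C`: it contains a midplane of `C`. -/
def Cuts (H : Set (Sym2 V)) (C : X.Cube) : Prop := ∃ M ⊆ H, X.IsMidplaneOf M C

/-- Two cubes are parallel if they have the same dimension and every hyperplane that cuts the
first also cuts the second. -/
def Parallel (C D : X.Cube) : Prop :=
  (∃ n, X.HasDim C n ∧ X.HasDim D n) ∧ ∀ H, X.IsHyperplane H → X.Cuts H C → X.Cuts H D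

/-- The parallelism classes of cubes of all dimensions. -/
def ParallelClass : Type _ := Quot X.Parallel

/-- `u` and `v` are diagonally opposite vertices of the cube `C`. -/
def IsOpposite (C : X.Cube) (u v : V) : Prop :=
  ∃ (n : ℕ) (φ : (Fin n → Bool) → V), IsCubeChart X.cubes φ C.1 ∧
    ∃ ε : Fin n → Bool, u = φ ε ∧ v = φ (fun i => !ε i)

/-- `X.IsNormalCubePath u w [C₀, …, Cₖ]`: the cubes `C₀, …, Cₖ`, of positive dimension, form
a normal cube path from `u` to `w`. There are vertices `u = v₀, v₁, …, vₖ₊₁ = w` such that `vᵢ`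
and `vᵢ₊₁` are diagonally opposite in `Cᵢ`, and `Cᵢ₊₁` meets the star of `Cᵢ` (the union
of all cubes having `Cᵢ` as a face) only in `vᵢ₊₁`. The empty path joins a vertex to itself. -/
inductive IsNormalCubePath : V → V → List X.Cube → Prop
  | refl (v : V) : IsNormalCubePath v v []
  | cons {u v w : V} {C : X.Cube} {L : List X.Cube} :
      X.IsOpposite C u v → u ≠ v → IsNormalCubePath v w L →
      (∀ D ∈ L.head?, ∀ E : X.Cube, C.1 ⊆ E.1 → E.1 ∩ D.1 = {v}) →
      IsNormalCubePath u w (C :: L)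

/-- The first cube of a normal cube path `L` starting at `v`; for the empty path it is the
`0`-cube `v`. -/
def firstCube (v : V) (L : List X.Cube) : X.Cube := L.headD (X.vertexCube v)

end CubeComplex

/-! Fix P and suppose vertices have a distance d to P such that every edge changes it by exactly
one, and two neighbours of v nearer to P lie with v in a square whose fourth corner is nearer still
(`IsCubicalDist`). Flag links then make the neighbours of Q nearer to P span a cube D Q, the
descending cube. The first cube of any normal cube path from Q to P is D Q
(`IsNormalCubePath.firstCube_eq`), and passing repeatedly to the corner of D Q opposite Q produces
such a path (`exists_isNormalCubePath`). So the map of the theorem is Q ↦ [D Q].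

It is injective because all edges of a hyperplane separate the same pairs of vertices
(`IsHyperplane.separates`). If D Q and D Q' are parallel, no neighbour of Q' is nearer to both Q and
P, so Q' lies on a geodesic from Q to P; by symmetry Q lies on one from Q' to P, and Q = Q'. It is
surjective because a cube C whose farthest vertex from P is Q is a face of D Q; if it is a proper
face, it is pushed to an opposite, parallel face of D Q nearer to P, and this terminates.

The distance comes from simple connectivity. Edge paths are taken up to swapping two consecutive
edges across a square; flag links make this transitive (`SwapEquiv.trans`). A path is reduced if no
equivalent path backtracks. Classes of reduced paths to P, joined by adding or dropping a first
edge, cover the 1-skeleton, and squares lift (`ReducedClass.isCoveringGraph`). Such a covering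
extends to a covering space of the realization, which has a section through each point over a vertex
(`IsCoveringGraph.exists_section`). Hence each vertex has exactly one reduced class to P, and d is
the common length of its members. -/

/-- The vertex of the combinatorial cube obtained by changing the `i`-th coordinate. -/
def flipAt {n : ℕ} (ε : Fin n → Bool) (i : Fin n) : Fin n → Bool := Function.update ε i (!ε i)

/-! ### Coordinate flips in a combinatorial cube -/

section flipAt

variable {n : ℕ} (ε : Fin n → Bool) {i j : Fin n}

@[simp] theorem flipAt_same : flipAt ε i i = !ε i := by simp [flipAt]

theorem flipAt_of_ne (h : j ≠ i) : flipAt ε i j = ε j := by simp [flipAt, h]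

@[simp] theorem flipAt_flipAt : flipAt (flipAt ε i) i = ε := by
  funext k
  by_cases h : k = i
  · subst h; simp
  · simp [flipAt_of_ne, h]

theorem flipAt_comm : flipAt (flipAt ε i) j = flipAt (flipAt ε j) i := by
  by_cases hij : i = j
  · rw [hij]
  funext k
  by_cases h : k = i
  · subst h; simp [flipAt_of_ne, hij]
  · by_cases h' : k = j
    · subst h'; simp [flipAt_of_ne, h]
    · simp [flipAt_of_ne, h, h']

theorem flipAt_ne_self : flipAt ε i ≠ ε := fun h => by
  simpa using congrFun h i

theorem flipAt_injective (h : flipAt ε i = flipAt ε j) : i = j := by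
  by_contra hij
  have := congrFun h i
  simp [flipAt_of_ne, hij] at this

theorem flipAt_flipAt_ne (hij : i ≠ j) (k : Fin n) : flipAt (flipAt ε i) j ≠ flipAt ε k := by
  intro h
  by_cases hk : k = i
  · subst hk
    exact flipAt_ne_self _ h
  · have h1 := congrFun h i
    rw [flipAt_of_ne _ hij, flipAt_of_ne _ (Ne.symm hk)] at h1
    simp at h1

theorem flipAt_flipAt_ne_self (hij : i ≠ j) : flipAt (flipAt ε i) j ≠ ε := by
  intro h
  have h1 := congrFun h i
  rw [flipAt_of_ne _ hij] at h1
  simp at h1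

/-- The coordinates where `δ` and `ε` differ are flipped one at a time; the induction is over a
finite set `S` containing them. -/
theorem flipAt_induction {p : (Fin n → Bool) → Prop} {ε : Fin n → Bool} (h0 : p ε)
    (step : ∀ δ i, p δ → p (flipAt δ i)) (δ : Fin n → Bool) : p δ := by
  suffices h : ∀ (S : Finset (Fin n)) (δ : Fin n → Bool), (∀ i ∉ S, δ i = ε i) → p δ from
    h Finset.univ δ (by simp)
  intro S
  induction S using Finset.induction_on with
  | empty =>
    intro δ h
    rwa [show δ = ε from funext fun i => h i (by simp)]
  | insert j S hj ih =>
    intro δ h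
    by_cases hδ : δ j = ε j
    · refine ih δ fun i hi => ?_
      by_cases hij : i = j
      · rw [hij, hδ]
      · exact h i (by simp [hij, hi])
    · rw [← flipAt_flipAt δ (i := j)]
      refine step _ _ (ih _ fun i hi => ?_)
      by_cases hij : i = j
      · subst hij
        rw [flipAt_same]
        exact Bool.not_eq.mpr hδ
      · rw [flipAt_of_ne _ hij]
        exact h i (by simp [hij, hi])

end flipAt

/-! ### Charts of cubes and their faces -/

namespace IsCubeChart

variable {V : Type*} {cubes : Set (Set V)} {n : ℕ} {φ : (Fin n → Bool) → V} {C : Set V}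

theorem mem (h : IsCubeChart cubes φ C) (ε : Fin n → Bool) : φ ε ∈ C := h.2.1 ▸ ⟨ε, rfl⟩

theorem exists_eq (h : IsCubeChart cubes φ C) {v : V} (hv : v ∈ C) : ∃ ε, φ ε = v := by
  rwa [← h.2.1] at hv

theorem mem_image_iff (h : IsCubeChart cubes φ C) {s : Finset (Fin n)} {a ε : Fin n → Bool} :
    φ ε ∈ φ '' stdFace s a ↔ ∀ i ∈ s, ε i = a i := by
  rw [h.1.mem_set_image]; rfl

theorem image_mem (h : IsCubeChart cubes φ C) (s : Finset (Fin n)) (a : Fin n → Bool) :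
    φ '' stdFace s a ∈ cubes :=
  (h.2.2 _ (by rw [← h.2.1]; exact Set.image_subset_range _ _)).2 ⟨s, a, rfl⟩

theorem ncard_eq (h : IsCubeChart cubes φ C) : C.ncard = 2 ^ n := by
  rw [← h.2.1, ← Set.image_univ, Set.ncard_image_of_injective _ h.1, Set.ncard_univ]
  simp

theorem finite (h : IsCubeChart cubes φ C) : C.Finite := by
  rw [← h.2.1]; exact Set.finite_range φ

/-- A face of a cube containing a vertex and all its neighbours is the whole cube. -/
theorem eq_of_forall_flipAt_mem (h : IsCubeChart cubes φ C) {D : Set V} (hD : D ∈ cubes)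
    (hDC : D ⊆ C) {ε : Fin n → Bool} (hε : φ ε ∈ D) (hflip : ∀ i, φ (flipAt ε i) ∈ D) :
    D = C := by
  obtain ⟨s, a, rfl⟩ := (h.2.2 D hDC).1 hD
  refine hDC.antisymm fun v hv => ?_
  obtain ⟨δ, rfl⟩ := h.exists_eq hv
  refine h.mem_image_iff.2 fun i hi => ?_
  have h1 := h.mem_image_iff.1 hε i hi
  have h2 := h.mem_image_iff.1 (hflip i) i hi
  rw [flipAt_same, h1] at h2
  simp at h2

end IsCubeChart

/-! ### Squares, and 3-cubes from flag links -/

namespace CubeComplex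

variable {V : Type*} (X : CubeComplex V)

/-- The vertices `v, a, c, b`, in this cyclic order, are those of a square of the complex. -/
def Square (v a c b : V) : Prop :=
  v ≠ c ∧ a ≠ b ∧ X.Adj v a ∧ X.Adj a c ∧ X.Adj c b ∧ X.Adj b v ∧ ({v, a, c, b} : Set V) ∈ X.cubes

variable {X}

theorem Adj.symm {v w : V} (h : X.Adj v w) : X.Adj w v :=
  ⟨h.1.symm, by rw [Set.pair_comm]; exact h.2⟩

namespace Square

variable {v a c b : V}

theorem reverse (h : X.Square v a c b) : X.Square v b c a := by
  obtain ⟨h1, h2, h3, h4, h5, h6, h7⟩ := h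
  refine ⟨h1, h2.symm, h6.symm, h5.symm, h4.symm, h3.symm, ?_⟩
  convert h7 using 1
  ext x; simp; tauto

theorem rotate (h : X.Square v a c b) : X.Square a c b v := by
  obtain ⟨h1, h2, h3, h4, h5, h6, h7⟩ := h
  refine ⟨h2, h1.symm, h4, h5, h6, h3, ?_⟩
  convert h7 using 1
  ext x; simp; tauto

theorem adj_left (h : X.Square v a c b) : X.Adj v a := h.2.2.1
theorem adj_right (h : X.Square v a c b) : X.Adj v b := h.2.2.2.2.2.1.symm
theorem adj_left' (h : X.Square v a c b) : X.Adj a c := h.2.2.2.1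
theorem adj_right' (h : X.Square v a c b) : X.Adj b c := h.2.2.2.2.1.symm
theorem ne (h : X.Square v a c b) : a ≠ b := h.2.1
theorem ne' (h : X.Square v a c b) : v ≠ c := h.1

end Square

theorem ncard_of_mem_cubes {C : Set V} (hC : C ∈ X.cubes) : ∃ n, C.ncard = 2 ^ n :=
  let ⟨n, _, h⟩ := X.exists_chart C hC
  ⟨n, h.ncard_eq⟩

theorem finite_of_mem_cubes {C : Set V} (hC : C ∈ X.cubes) : C.Finite :=
  let ⟨_, _, h⟩ := X.exists_chart C hC
  h.finite

theorem Square.ncard {v a c b : V} (h : X.Square v a c b) : ({v, a, c, b} : Set V).ncard = 4 := by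
  obtain ⟨h1, h2, h3, h4, h5, h6, h7⟩ := h
  rw [Set.ncard_insert_of_notMem, Set.ncard_insert_of_notMem, Set.ncard_pair h5.1]
  · simp [h4.1, h2]
  · simp [h1, h3.1, h6.1.symm]

/-- A square is determined by two of its adjacent edges. -/
theorem Square.unique {v a c b c' : V} (h : X.Square v a c b) (h' : X.Square v a c' b) :
    c = c' := by
  set C : Set V := {v, a, c, b}
  set D : Set V := {v, a, c', b}
  have hC : C ∈ X.cubes := h.2.2.2.2.2.2
  have hD : D ∈ X.cubes := h'.2.2.2.2.2.2
  have hv : v ∈ C ∩ D := by simp [C, D]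
  have hI := X.inter_mem C hC D hD ⟨v, hv⟩
  obtain ⟨n, hn⟩ := ncard_of_mem_cubes hI
  have hle : (C ∩ D).ncard ≤ C.ncard :=
    Set.ncard_le_ncard Set.inter_subset_left (finite_of_mem_cubes hC)
  have h3 : ({v, a, b} : Set V).ncard = 3 := by
    rw [Set.ncard_insert_of_notMem, Set.ncard_pair h.ne]
    simp [h.adj_left.1, h.adj_right.1]
  have hge : ({v, a, b} : Set V).ncard ≤ (C ∩ D).ncard := by
    refine Set.ncard_le_ncard ?_ (finite_of_mem_cubes hI)
    intro x; simp [C, D]; tauto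
  have hC4 : C.ncard = 4 := h.ncard
  -- The intersection is a cube, so its number of vertices is a power of two; being at least 3, it
  -- is at least 4.
  have h4 : 4 ≤ (C ∩ D).ncard := by
    rw [h3] at hge
    rw [hn] at hge ⊢
    have : 2 ≤ n := by
      by_contra hlt
      have : n ≤ 1 := by omega
      have : 2 ^ n ≤ 2 ^ 1 := Nat.pow_le_pow_right (by norm_num) this
      omega
    exact Nat.pow_le_pow_right (n := 2) (by norm_num) this
  have hEq : C ∩ D = C :=
    Set.eq_of_subset_of_ncard_le Set.inter_subset_left (by omega) (finite_of_mem_cubes hC)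
  have hc : c ∈ C ∩ D := by rw [hEq]; simp [C]
  have := hc.2
  simp only [D, Set.mem_insert_iff, Set.mem_singleton_iff] at this
  rcases this with h1 | h1 | h1 | h1
  · exact absurd h1.symm h.ne'
  · exact absurd h1.symm h.adj_left'.1
  · exact h1
  · exact absurd h1.symm h.adj_right'.1

theorem Square.unique' {v a c b b' : V} (h : X.Square v a c b) (h' : X.Square v a c b') :
    b = b' :=
  Square.unique h.rotate.reverse h'.rotate.reverse

section chart

variable {n : ℕ} {φ : (Fin n → Bool) → V} {C : Set V}

theorem adj_flipAt (h : IsCubeChart X.cubes φ C) (ε : Fin n → Bool) (i : Fin n) :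
    X.Adj (φ ε) (φ (flipAt ε i)) := by
  refine ⟨fun he => flipAt_ne_self ε (h.1 he).symm, ?_⟩
  convert h.image_mem (Finset.univ.erase i) ε using 1
  ext v
  constructor
  · rintro (rfl | rfl)
    · exact h.mem_image_iff.2 fun _ _ => rfl
    · exact h.mem_image_iff.2 fun j hj => flipAt_of_ne _ (Finset.ne_of_mem_erase hj)
  · rintro ⟨δ, hδ, rfl⟩
    by_cases hi : δ i = ε i
    · left
      congr 1
      funext j
      by_cases hj : j = i
      · rw [hj, hi]
      · exact hδ j (by simp [hj])
    · right
      show φ δ = _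
      congr 1
      funext j
      by_cases hj : j = i
      · subst hj; rw [flipAt_same]; exact Bool.eq_not.mpr hi
      · rw [flipAt_of_ne _ hj]; exact hδ j (by simp [hj])

/-- The edge is a face of the chart. A coordinate in which its ends differ is free on that face, so
the face contains the flip of `ε` there, which can only be the other end. -/
theorem exists_eq_flipAt (h : IsCubeChart X.cubes φ C) {ε : Fin n → Bool} {w : V} (hw : w ∈ C)
    (hadj : X.Adj (φ ε) w) : ∃ i, w = φ (flipAt ε i) := by
  obtain ⟨δ, rfl⟩ := h.exists_eq hw
  have hsub : ({φ ε, φ δ} : Set V) ⊆ C := by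
    rintro x (rfl | rfl) <;> exact h.mem _
  obtain ⟨s, a, hs⟩ := (h.2.2 _ hsub).1 hadj.2
  have hne : ε ≠ δ := fun he => hadj.1 (by rw [he])
  obtain ⟨i, hi⟩ := Function.ne_iff.1 hne
  have hε : ∀ j ∈ s, ε j = a j := h.mem_image_iff.1 (hs ▸ Set.mem_insert _ _)
  have hδ : ∀ j ∈ s, δ j = a j := h.mem_image_iff.1 (hs ▸ Set.mem_insert_of_mem _ rfl)
  have his : i ∉ s := fun his => hi ((hε i his).trans (hδ i his).symm)
  have hmem : φ (flipAt ε i) ∈ ({φ ε, φ δ} : Set V) := by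
    rw [hs]
    refine h.mem_image_iff.2 fun j hj => ?_
    rw [flipAt_of_ne _ (by rintro rfl; exact his hj), hε j hj]
  rcases hmem with h1 | h1
  · exact absurd (h.1 h1) (flipAt_ne_self ε)
  · exact ⟨i, h1.symm⟩

theorem square_flipAt (h : IsCubeChart X.cubes φ C) (ε : Fin n → Bool) {i j : Fin n}
    (hij : i ≠ j) :
    X.Square (φ ε) (φ (flipAt ε i)) (φ (flipAt (flipAt ε i) j)) (φ (flipAt ε j)) := by
  refine ⟨fun he => flipAt_flipAt_ne_self ε hij (h.1 he).symm,
    fun he => hij (flipAt_injective ε (h.1 he)), adj_flipAt h _ _, adj_flipAt h _ _, ?_,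
    (adj_flipAt h _ _).symm, ?_⟩
  · rw [flipAt_comm]; exact (adj_flipAt h _ _).symm
  convert h.image_mem ((Finset.univ.erase i).erase j) ε using 1
  have hcase : ∀ δ δ' : Fin n → Bool, δ i = δ' i → δ j = δ' j →
      (∀ k, k ≠ i → k ≠ j → δ k = δ' k) → δ = δ' := fun δ δ' h1 h2 h3 => by
    funext k
    by_cases hi : k = i
    · rw [hi, h1]
    · by_cases hj : k = j
      · rw [hj, h2]
      · exact h3 k hi hj
  ext v
  constructor
  · rintro (rfl | rfl | rfl | rfl) <;>
    · refine h.mem_image_iff.2 fun k hk => ?_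
      simp only [Finset.mem_erase, Finset.mem_univ, and_true] at hk
      simp [flipAt_of_ne, hk.1, hk.2]
  · rintro ⟨δ, hδ, rfl⟩
    have hδ' : ∀ k, k ≠ i → k ≠ j → δ k = ε k := fun k h1 h2 => hδ k (by simp [h1, h2])
    by_cases hi : δ i = ε i <;> by_cases hj : δ j = ε j
    · left
      rw [hcase δ ε hi hj hδ']
    · right; right; right
      show φ δ = _
      rw [hcase δ (flipAt ε j) (by rw [flipAt_of_ne _ hij, hi])
        (by rw [flipAt_same]; exact Bool.eq_not.mpr hj)
        fun k h1 h2 => by rw [flipAt_of_ne _ h2, hδ' k h1 h2]]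
    · right; left
      rw [hcase δ (flipAt ε i) (by rw [flipAt_same]; exact Bool.eq_not.mpr hi)
        (by rw [flipAt_of_ne _ hij.symm, hj])
        fun k h1 h2 => by rw [flipAt_of_ne _ h1, hδ' k h1 h2]]
    · right; right; left
      rw [hcase δ (flipAt (flipAt ε i) j)
        (by rw [flipAt_of_ne _ hij, flipAt_same]; exact Bool.eq_not.mpr hi)
        (by rw [flipAt_same, flipAt_of_ne _ hij.symm]; exact Bool.eq_not.mpr hj)
        fun k h1 h2 => by rw [flipAt_of_ne _ h2, flipAt_of_ne _ h1, hδ' k h1 h2]]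

end chart

/-- Two diagonally opposite vertices of a square are not adjacent. -/
theorem Square.not_adj {v a c b : V} (h : X.Square v a c b) : ¬ X.Adj v c := by
  intro hvc
  obtain ⟨n, φ, hφ⟩ := X.exists_chart _ h.2.2.2.2.2.2
  obtain ⟨ε, hε⟩ := hφ.exists_eq (v := v) (by simp)
  subst hε
  obtain ⟨i, hi⟩ := exists_eq_flipAt hφ (by simp) h.adj_left
  obtain ⟨j, hj⟩ := exists_eq_flipAt hφ (by simp) h.adj_right
  obtain ⟨k, hk⟩ := exists_eq_flipAt hφ (by simp) hvc
  have hij : i ≠ j := fun hij => h.ne (by rw [hi, hj, hij])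
  have hmem := hφ.mem (flipAt (flipAt ε i) j)
  have key : ∀ k, φ (flipAt (flipAt ε i) j) ≠ φ (flipAt ε k) := fun k he =>
    flipAt_flipAt_ne ε hij k (hφ.1 he)
  simp only [Set.mem_insert_iff, Set.mem_singleton_iff] at hmem
  rcases hmem with h1 | h1 | h1 | h1
  · exact flipAt_flipAt_ne_self ε hij (hφ.1 h1)
  · exact key i (h1.trans hi)
  · exact key k (h1.trans hk)
  · exact key j (h1.trans hj)

theorem Square.isLinkSimplex {v a c b : V} (h : X.Square v a c b) : X.IsLinkSimplex v {a, b} := by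
  refine ⟨_, h.2.2.2.2.2.2, by simp, ?_⟩
  ext w
  simp only [Set.mem_insert_iff, Set.mem_singleton_iff, Set.mem_ofPred_eq]
  constructor
  · rintro (rfl | rfl)
    · exact ⟨by simp, h.adj_left⟩
    · exact ⟨by simp, h.adj_right⟩
  · rintro ⟨rfl | rfl | rfl | rfl, hadj⟩
    · exact absurd rfl hadj.1
    · simp
    · exact absurd hadj h.not_adj
    · simp

/-- In a complex with flag links, three squares pairwise sharing an edge at a common vertex are
faces of a `3`-cube. -/
theorem Square.exists_cube (hflag : ∀ v, X.IsFlagLink v) {v a b c x y z : V}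
    (hab : X.Square v a x b) (hbc : X.Square v b y c) (hac : X.Square v a z c) :
    ∃ t, X.Square a x t z ∧ X.Square b x t y ∧ X.Square c y t z := by
  -- Each square joins two of `a`, `b`, `c` in the link of `v`, so flagness puts all three in one
  -- cube. Uniqueness of squares then identifies `x`, `y`, `z` with vertices of its chart.
  obtain ⟨C, hC, hv, hS⟩ := hflag v {a, b, c} (by simp)
    (by
      rintro w (rfl | rfl | rfl)
      exacts [hab.adj_left, hbc.adj_left, hac.adj_right])
    (by
      rintro w (rfl | rfl | rfl) w' (rfl | rfl | rfl) hne
      · exact absurd rfl hne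
      · exact hab.isLinkSimplex
      · exact hac.isLinkSimplex
      · exact hab.reverse.isLinkSimplex
      · exact absurd rfl hne
      · exact hbc.isLinkSimplex
      · exact hac.reverse.isLinkSimplex
      · exact hbc.reverse.isLinkSimplex
      · exact absurd rfl hne)
  have ha : a ∈ C := by
    have : a ∈ ({a, b, c} : Set V) := by simp
    rw [hS] at this; exact this.1
  have hb : b ∈ C := by
    have : b ∈ ({a, b, c} : Set V) := by simp
    rw [hS] at this; exact this.1
  have hc : c ∈ C := by
    have : c ∈ ({a, b, c} : Set V) := by simp
    rw [hS] at this; exact this.1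
  obtain ⟨n, φ, hφ⟩ := X.exists_chart C hC
  obtain ⟨ε, rfl⟩ := hφ.exists_eq hv
  obtain ⟨i, rfl⟩ := exists_eq_flipAt hφ ha hab.adj_left
  obtain ⟨j, rfl⟩ := exists_eq_flipAt hφ hb hbc.adj_left
  obtain ⟨k, rfl⟩ := exists_eq_flipAt hφ hc hac.adj_right
  have hij : i ≠ j := fun h => hab.ne (by rw [h])
  have hjk : j ≠ k := fun h => hbc.ne (by rw [h])
  have hik : i ≠ k := fun h => hac.ne (by rw [h])
  obtain rfl := hab.unique (square_flipAt hφ ε hij)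
  obtain rfl := hbc.unique (square_flipAt hφ ε hjk)
  obtain rfl := hac.unique (square_flipAt hφ ε hik)
  refine ⟨φ (flipAt (flipAt (flipAt ε i) j) k), square_flipAt hφ _ hjk, ?_, ?_⟩
  · rw [flipAt_comm ε (i := i) (j := j)]
    exact square_flipAt hφ _ hik
  · rw [flipAt_comm ε (i := j) (j := k), flipAt_comm ε (i := i) (j := k),
      flipAt_comm (flipAt ε i) (j := k), flipAt_comm ε (i := i) (j := k),
      flipAt_comm (flipAt ε k)]
    exact square_flipAt hφ _ hij.symm

end CubeComplex

/-! ### Edge paths up to swaps across squares -/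

namespace CubeComplex

variable {V : Type*} (X : CubeComplex V)

/-- Equivalence of edge paths of the same length under swaps of two consecutive edges of a square.
A path starting at a vertex is given by the list of the subsequent vertices. -/
inductive SwapEquiv : V → List V → List V → Prop
  | nil (v : V) : SwapEquiv v [] []
  | cons {v a : V} {u u' : List V} : X.Adj v a → SwapEquiv a u u' → SwapEquiv v (a :: u) (a :: u')
  | swap {v a c b : V} {u u' t : List V} : X.Square v a c b → SwapEquiv a u (c :: t) →
      SwapEquiv b u' (c :: t) → SwapEquiv v (a :: u) (b :: u')

/-- An edge path is reduced if no equivalent path backtracks. -/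
inductive IsReduced : V → List V → Prop
  | nil (v : V) : IsReduced v []
  | cons {v a : V} {u : List V} : X.Adj v a → IsReduced a u →
      (∀ t, ¬ X.SwapEquiv a u (v :: t)) → IsReduced v (a :: u)

variable {X}

namespace SwapEquiv

variable {v a b c : V} {w w' w'' u u' t : List V}

theorem length_eq (h : X.SwapEquiv v w w') : w.length = w'.length := by
  induction h with
  | nil => rfl
  | cons _ _ ih => simp [ih]
  | swap _ _ _ ih ih' => simp [ih, ih']

theorem getLastD_eq (h : X.SwapEquiv v w w') : w.getLastD v = w'.getLastD v := by
  induction h with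
  | nil => rfl
  | cons _ _ ih => rw [List.getLastD_cons, List.getLastD_cons, ih]
  | swap _ _ _ ih ih' =>
    rw [List.getLastD_cons] at ih ih'
    rw [List.getLastD_cons, List.getLastD_cons, ih, ih']

theorem symm (h : X.SwapEquiv v w w') : X.SwapEquiv v w' w := by
  induction h with
  | nil => exact .nil _
  | cons h _ ih => exact .cons h ih
  | swap h h1 h2 => exact .swap h.reverse h2 h1

theorem refl_left (h : X.SwapEquiv v w w') : X.SwapEquiv v w w := by
  induction h with
  | nil => exact .nil _
  | cons h _ ih => exact .cons h ih
  | swap h _ _ ih => exact .cons h.adj_left ih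

theorem refl_right (h : X.SwapEquiv v w w') : X.SwapEquiv v w' w' := h.symm.refl_left

theorem tail_refl (h : X.SwapEquiv v (a :: u) w) : X.SwapEquiv a u u := by
  cases h with
  | cons _ h => exact h.refl_left
  | swap _ h _ => exact h.refl_left

theorem adj (h : X.SwapEquiv v (a :: u) w) : X.Adj v a := by
  cases h with
  | cons h _ => exact h
  | swap h _ _ => exact h.adj_left

theorem cancel (h : X.SwapEquiv v (a :: u) (a :: u')) : X.SwapEquiv a u u' := by
  cases h with
  | cons _ h => exact h
  | swap h _ _ => exact absurd rfl h.ne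

theorem of_square (h : X.Square v a c b) (ht : X.SwapEquiv c t t) :
    X.SwapEquiv v (a :: c :: t) (b :: c :: t) :=
  .swap h (.cons h.adj_left' ht) (.cons h.adj_right' ht)

/-- Since `SwapEquiv` allows at most one swap at the head, `cancel` and `exists_square` are mere
case distinctions and transitivity carries the content. By induction on length, the essential case
is two head swaps, from `a` to `b` and from `b` to `c`. -/
theorem trans (hflag : ∀ v, X.IsFlagLink v) (h : X.SwapEquiv v w w')
    (h' : X.SwapEquiv v w' w'') : X.SwapEquiv v w w'' := by
  suffices H : ∀ (n : ℕ) (v : V) (w w' w'' : List V), w.length = n → X.SwapEquiv v w w' →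
      X.SwapEquiv v w' w'' → X.SwapEquiv v w w'' from H _ v w w' w'' rfl h h'
  clear h h'
  intro n
  induction n with
  | zero =>
    intro v w w' w'' hn h h'
    obtain rfl := List.length_eq_zero_iff.1 hn
    obtain rfl := List.length_eq_zero_iff.1 (h.length_eq.symm.trans hn)
    exact h'
  | succ n ih =>
    intro v w w' w'' hn h h'
    cases h with
    | nil => simp at hn
    | @cons _ a u u' hva h =>
      have hu : u.length = n := by simpa using hn
      cases h' with
      | cons _ h' => exact .cons hva (ih _ _ _ _ hu h h')
      | swap hs h1 h2 => exact .swap hs (ih _ _ _ _ hu h h1) h2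
    | @swap _ a x b u u' t hs h1 h2 =>
      have hu : u.length = n := by simpa using hn
      have hu' : u'.length = n := by rw [h2.length_eq, ← h1.length_eq, hu]
      cases h' with
      | @cons _ _ _ u'' _ h' =>
        have hu'' : u''.length = n := by rw [← h'.length_eq, hu']
        exact .swap hs h1 (ih _ _ _ _ hu'' h'.symm h2)
      | @swap _ _ y c _ u'' s hs' h3 h4 =>
        have hxy := ih _ _ _ _ (h2.length_eq.symm.trans hu') h2.symm h3
        have hu'' : u''.length = n := by rw [h4.length_eq, ← h3.length_eq, hu']
        by_cases hac : a = c
        · subst hac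
          obtain rfl := hs.unique hs'.reverse
          exact .cons hs.adj_left (ih _ _ _ _ hu (ih _ _ _ _ hu h1 (.cons hs.adj_left' hxy.cancel))
            h4.symm)
        · cases hxy with
          | cons _ _ => exact absurd (Square.unique' hs.reverse hs') hac
          | @swap _ _ p _ _ _ r hsq h5 h6 =>
            -- Three squares meet pairwise in edges at `b`, whose neighbours `v`, `x`, `y` they
            -- involve. In the resulting 3-cube the corner `z` opposite `b` completes a square on
            -- `v`, `a`, `c`, which gives the direct swap from `a` to `c`.
            obtain ⟨z, h7, h8, h9⟩ := Square.exists_cube hflag hs.rotate.rotate.rotate hsq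
              hs'.rotate.reverse
            have hr : X.SwapEquiv p r r := h5.symm.tail_refl
            have e1 : X.SwapEquiv a u (z :: p :: r) :=
              ih _ _ _ _ hu (ih _ _ _ _ hu h1 (.cons hs.adj_left' h5)) (of_square h8.reverse.rotate.rotate.rotate hr)
            have e2 : X.SwapEquiv c u'' (z :: p :: r) :=
              ih _ _ _ _ hu'' (ih _ _ _ _ hu'' h4 (.cons hs'.adj_right' h6))
                (of_square h9.rotate.rotate.rotate hr)
            exact .swap h7 e1 e2

/-- An edge path that can be rewritten to start with either of two distinct edges can be rewritten
to start with either side of a square. -/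
theorem exists_square (h : X.SwapEquiv v (a :: u) (b :: u')) (hab : a ≠ b) :
    ∃ c t, X.Square v a c b ∧ X.SwapEquiv a u (c :: t) ∧ X.SwapEquiv b u' (c :: t) := by
  cases h with
  | cons _ _ => exact absurd rfl hab
  | swap h h1 h2 => exact ⟨_, _, h, h1, h2⟩

/-- If an edge path can be rewritten to start with either of two adjacent edges of a square,
then after removing the first one it can be rewritten to start with the opposite of the second. -/
theorem of_square_of_square (hs : X.Square v a c b) (h : X.SwapEquiv v (a :: u) (b :: u')) :
    ∃ t, X.SwapEquiv a u (c :: t) ∧ X.SwapEquiv b u' (c :: t) := by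
  obtain ⟨c', t, hs', h1, h2⟩ := h.exists_square hs.ne
  obtain rfl := hs.unique hs'
  exact ⟨t, h1, h2⟩

end SwapEquiv

namespace IsReduced

variable {v a b c : V} {w w' u t : List V}

theorem refl (h : X.IsReduced v w) : X.SwapEquiv v w w := by
  induction h with
  | nil => exact .nil _
  | cons h _ _ ih => exact .cons h ih

theorem tail (h : X.IsReduced v (a :: u)) : X.IsReduced a u := by
  cases h with
  | cons _ h _ => exact h

theorem not_swapEquiv (h : X.IsReduced v (a :: u)) (t : List V) :
    ¬ X.SwapEquiv a u (v :: t) := by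
  cases h with
  | cons _ _ h => exact h t

/-- Induction on length. For a head swap across the square `v a c b`, a backtrack in `b :: c :: t`
at its second edge would let `u` be rewritten to return to `v`; one at its first edge would let `t`
be rewritten to start with `a`, contradicting that `c :: t` is reduced from `a`. -/
theorem of_swapEquiv (hflag : ∀ v, X.IsFlagLink v) (h : X.SwapEquiv v w w')
    (hw : X.IsReduced v w) : X.IsReduced v w' := by
  suffices H : ∀ (n : ℕ) (v : V) (w w' : List V), w.length = n → X.SwapEquiv v w w' →
      X.IsReduced v w → X.IsReduced v w' from H _ v w w' rfl h hw
  clear h hw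
  intro n
  induction n with
  | zero =>
    intro v w w' hn h hw
    obtain rfl := List.length_eq_zero_iff.1 hn
    obtain rfl := List.length_eq_zero_iff.1 (h.length_eq.symm.trans hn)
    exact hw
  | succ n ih =>
    intro v w w' hn h hw
    cases h with
    | nil => exact hw
    | cons hva h =>
      exact .cons hva (ih _ _ _ (by simpa using hn) h hw.tail)
        fun t ht => hw.not_swapEquiv t (h.trans hflag ht)
    | @swap _ a c b u u' t hs h1 h2 =>
      have hu : u.length = n := by simpa using hn
      have hct := ih _ _ _ hu h1 hw.tail
      have hbct : X.IsReduced b (c :: t) := by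
        refine .cons hs.adj_right' hct.tail fun s h => ?_
        refine hw.not_swapEquiv (b :: s) ((h1.trans hflag (.cons hs.adj_left' h)).trans hflag ?_)
        exact .of_square hs.rotate h.refl_right.tail_refl
      refine .cons hs.adj_right (ih _ _ _ ?_ h2.symm hbct) fun s h => ?_
      · rw [← h1.length_eq, hu]
      · obtain ⟨r, h3, h4⟩ := SwapEquiv.of_square_of_square hs.rotate.rotate.rotate.reverse
          (h2.symm.trans hflag h)
        exact hct.not_swapEquiv r h3

end IsReduced

end CubeComplex

/-! ### Reduced classes as a covering of the 1-skeleton -/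

namespace CubeComplex

variable {V : Type*} (X : CubeComplex V)

/-- The relation `E` on `T` makes `π : T → V` a covering of the `1`-skeleton of `X` along which
squares lift. -/
structure IsCoveringGraph {T : Type*} (π : T → V) (E : T → T → Prop) : Prop where
  symm : ∀ {x y}, E x y → E y x
  adj : ∀ {x y}, E x y → X.Adj (π x) (π y)
  unique : ∀ {x y y'}, E x y → E x y' → π y = π y' → y = y'
  exists_lift : ∀ x {w}, X.Adj (π x) w → ∃ y, π y = w ∧ E x y
  exists_square : ∀ x {a c b}, X.Square (π x) a c b →
    ∃ y y' z, π y = a ∧ π y' = b ∧ π z = c ∧ E x y ∧ E x y' ∧ E y z ∧ E y' z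

/-- The reduced edge paths to `P` up to swaps, as pairs of a starting vertex and a class. -/
def ReducedClass (P : V) : Type _ :=
  {x : V × Set (List V) // ∃ w, X.IsReduced x.1 w ∧ w.getLastD x.1 = P ∧
    x.2 = {w' | X.SwapEquiv x.1 w w'}}

variable {X}

namespace ReducedClass

variable {P : V}

/-- The class of a reduced edge path. -/
def mk {v : V} {w : List V} (h : X.IsReduced v w) (hP : w.getLastD v = P) : X.ReducedClass P :=
  ⟨(v, {w' | X.SwapEquiv v w w'}), w, h, hP, rfl⟩

/-- The starting vertex of a class of edge paths. -/
def start (x : X.ReducedClass P) : V := x.1.1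

/-- One of two classes is obtained from the other by adding an edge at the start. -/
def IsStep (x y : X.ReducedClass P) : Prop :=
  (∃ w ∈ y.1.2, y.start :: w ∈ x.1.2) ∨ (∃ w ∈ x.1.2, x.start :: w ∈ y.1.2)

theorem IsStep.symm {x y : X.ReducedClass P} (h : IsStep x y) : IsStep y x := Or.symm h

theorem exists_rep (x : X.ReducedClass P) : ∃ (v : V) (w : List V) (h : X.IsReduced v w)
    (hP : w.getLastD v = P), x = mk h hP := by
  obtain ⟨⟨v, S⟩, w, h, hP, hS⟩ := x
  dsimp at hS
  subst hS
  exact ⟨v, w, h, hP, rfl⟩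

theorem mk_eq_mk (hflag : ∀ v, X.IsFlagLink v) {v : V} {w w' : List V} (h : X.IsReduced v w)
    (hP : w.getLastD v = P) (h' : X.IsReduced v w') (hP' : w'.getLastD v = P)
    (hw : X.SwapEquiv v w w') : mk h hP = mk h' hP' := by
  refine Subtype.ext (Prod.ext rfl (Set.ext fun u => ?_))
  exact ⟨fun hu => hw.symm.trans hflag hu, fun hu => hw.trans hflag hu⟩

theorem swapEquiv_of_mk_eq_mk {v : V} {w w' : List V} {h : X.IsReduced v w}
    {hP : w.getLastD v = P} {h' : X.IsReduced v w'} {hP' : w'.getLastD v = P}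
    (he : mk h hP = mk h' hP') : X.SwapEquiv v w w' := by
  have : w' ∈ (mk h hP).1.2 := by rw [he]; exact h'.refl
  exact this

theorem isStep_mk {v a : V} {u : List V} (h : X.IsReduced v (a :: u)) (h' : X.IsReduced a u)
    (hP : (a :: u).getLastD v = P) (hP' : u.getLastD a = P) : IsStep (mk h hP) (mk h' hP') :=
  Or.inl ⟨u, h'.refl, h.refl⟩

theorem isStep_mk_iff (hflag : ∀ v, X.IsFlagLink v) {v a : V} {w u : List V}
    (h : X.IsReduced v w) (h' : X.IsReduced a u)
    (hP : w.getLastD v = P) (hP' : u.getLastD a = P) : IsStep (mk h hP) (mk h' hP') ↔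
      X.SwapEquiv v w (a :: u) ∨ X.SwapEquiv a u (v :: w) := by
  constructor
  · rintro (⟨s, hs, hs'⟩ | ⟨s, hs, hs'⟩)
    · exact .inl (SwapEquiv.trans hflag hs' (.cons (SwapEquiv.adj hs'.symm) (SwapEquiv.symm hs)))
    · exact .inr (SwapEquiv.trans hflag hs' (.cons (SwapEquiv.adj hs'.symm) (SwapEquiv.symm hs)))
  · rintro (hs | hs)
    · exact .inl ⟨u, h'.refl, hs⟩
    · exact .inr ⟨w, h.refl, hs⟩

/-- The reduced edge paths to a given vertex form a covering of the `1`-skeleton. -/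
theorem isCoveringGraph (hflag : ∀ v, X.IsFlagLink v) (P : V) :
    X.IsCoveringGraph (start (X := X) (P := P)) IsStep := by
  refine ⟨IsStep.symm, ?_, ?_, ?_, ?_⟩
  · rintro x y (⟨w, -, h⟩ | ⟨w, -, h⟩)
    all_goals obtain ⟨v, u, hu, hP, rfl⟩ := exists_rep x
    all_goals obtain ⟨v', u', hu', hP', rfl⟩ := exists_rep y
    · exact (SwapEquiv.symm h).adj
    · exact (SwapEquiv.symm h).adj.symm
  · intro x y y' h h' he
    obtain ⟨v, w, hw, hP, rfl⟩ := exists_rep x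
    obtain ⟨a, u, hu, hP1, rfl⟩ := exists_rep y
    obtain ⟨b, u', hu', hP2, rfl⟩ := exists_rep y'
    obtain rfl : a = b := he
    rw [isStep_mk_iff hflag] at h h'
    apply mk_eq_mk hflag
    -- The two lifts over `a` both drop an edge or both add one. In the mixed cases the longer path
    -- could be rewritten to go to `v` and straight back to `a`, so it would not be reduced.
    rcases h with h | h <;> rcases h' with h' | h'
    · exact (h.symm.trans hflag h').cancel
    · exact absurd h ((hu'.of_swapEquiv hflag h').not_swapEquiv u)
    · exact absurd h' ((hu.of_swapEquiv hflag h).not_swapEquiv u')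
    · exact h.trans hflag h'.symm
  · intro x v' hadj
    obtain ⟨v, w, hw, hP, rfl⟩ := exists_rep x
    by_cases hex : ∃ u, X.SwapEquiv v w (v' :: u)
    · obtain ⟨u, hu⟩ := hex
      have hr := (hw.of_swapEquiv hflag hu).tail
      have hP' : u.getLastD v' = P := by rw [← hP, hu.getLastD_eq, List.getLastD_cons]
      exact ⟨mk hr hP', rfl, (isStep_mk_iff hflag ..).2 (.inl hu)⟩
    · have hr : X.IsReduced v' (v :: w) := .cons hadj.symm hw fun t ht => hex ⟨t, ht⟩
      have hP' : (v :: w).getLastD v' = P := by rw [List.getLastD_cons, hP]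
      exact ⟨mk hr hP', rfl, (isStep_mk hr hw hP' hP).symm⟩
  · intro x a c b hs
    have main : ∀ (v : V) (w : List V) (hw : X.IsReduced v w) (hP : w.getLastD v = P) (a c b : V),
        X.Square v a c b → (¬ ∃ u', X.SwapEquiv v w (b :: u')) →
        ∃ y y' z : X.ReducedClass P, y.start = a ∧ y'.start = b ∧ z.start = c ∧
          IsStep (mk hw hP) y ∧ IsStep (mk hw hP) y' ∧ IsStep y z ∧ IsStep y' z := by
      intro v w hw hP a c b hs hb
      have hrb : X.IsReduced b (v :: w) := .cons hs.adj_right.symm hw fun t ht => hb ⟨t, ht⟩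
      have hPb : (v :: w).getLastD b = P := by rw [List.getLastD_cons, hP]
      by_cases ha : ∃ u, X.SwapEquiv v w (a :: u)
      · obtain ⟨u, hu⟩ := ha
        have hr := hw.of_swapEquiv hflag hu
        have hPa : u.getLastD a = P := by rw [← hP, hu.getLastD_eq, List.getLastD_cons]
        have hrc : X.IsReduced c (a :: u) := by
          refine .cons hs.adj_left'.symm hr.tail fun t ht => hb ⟨c :: t, ?_⟩
          exact hu.trans hflag ((SwapEquiv.cons hs.adj_left ht).trans hflag
            (.of_square hs ht.refl_right.tail_refl))
        have hPc : (a :: u).getLastD c = P := by rw [List.getLastD_cons, hPa]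
        refine ⟨mk hr.tail hPa, mk hrb hPb, mk hrc hPc, rfl, rfl, rfl,
          (isStep_mk_iff hflag ..).2 (.inl hu), (isStep_mk hrb hw hPb hP).symm,
          (isStep_mk hrc hr.tail hPc hPa).symm, (isStep_mk_iff hflag ..).2 (.inl ?_)⟩
        exact (SwapEquiv.cons hs.adj_right.symm hu).trans hflag
          (.of_square hs.rotate.rotate.rotate hr.tail.refl)
      · have hra : X.IsReduced a (v :: w) := .cons hs.adj_left.symm hw fun t ht => ha ⟨t, ht⟩
        have hPa : (v :: w).getLastD a = P := by rw [List.getLastD_cons, hP]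
        have hrc : X.IsReduced c (a :: v :: w) := by
          refine .cons hs.adj_left'.symm hra fun t ht => hb ?_
          obtain ⟨r, hr, -⟩ := SwapEquiv.of_square_of_square hs.rotate.reverse ht
          exact ⟨r, hr⟩
        have hPc : (a :: v :: w).getLastD c = P := by rw [List.getLastD_cons, hPa]
        refine ⟨mk hra hPa, mk hrb hPb, mk hrc hPc, rfl, rfl, rfl,
          (isStep_mk hra hw hPa hP).symm, (isStep_mk hrb hw hPb hP).symm,
          (isStep_mk hrc hra hPc hPa).symm, (isStep_mk_iff hflag ..).2 (.inr ?_)⟩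
        exact .of_square hs.rotate.rotate.reverse hw.refl
    obtain ⟨v, w, hw, hP, rfl⟩ := exists_rep x
    by_cases hb : ∃ u', X.SwapEquiv v w (b :: u')
    · by_cases ha : ∃ u, X.SwapEquiv v w (a :: u)
      · obtain ⟨u, hu⟩ := ha
        obtain ⟨u', hu'⟩ := hb
        have hra := (hw.of_swapEquiv hflag hu).tail
        have hrb := (hw.of_swapEquiv hflag hu').tail
        have hPa : u.getLastD a = P := by rw [← hP, hu.getLastD_eq, List.getLastD_cons]
        have hPb : u'.getLastD b = P := by rw [← hP, hu'.getLastD_eq, List.getLastD_cons]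
        obtain ⟨t, h1, h2⟩ := SwapEquiv.of_square_of_square hs (hu.symm.trans hflag hu')
        have hrc := (hra.of_swapEquiv hflag h1).tail
        have hPc : t.getLastD c = P := by rw [← hPa, h1.getLastD_eq, List.getLastD_cons]
        exact ⟨mk hra hPa, mk hrb hPb, mk hrc hPc, rfl, rfl, rfl,
          (isStep_mk_iff hflag ..).2 (.inl hu), (isStep_mk_iff hflag ..).2 (.inl hu'),
          (isStep_mk_iff hflag ..).2 (.inl h1), (isStep_mk_iff hflag ..).2 (.inl h2)⟩
      · obtain ⟨y, y', z, h1, h2, h3, h4, h5, h6, h7⟩ := main v w hw hP b c a hs.reverse ha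
        exact ⟨y', y, z, h2, h1, h3, h5, h4, h7, h6⟩
    · exact main v w hw hP a c b hs hb

end ReducedClass

end CubeComplex

/-! ### Lifting cubes along a covering graph -/

namespace CubeComplex

variable {V : Type*} {X : CubeComplex V}

namespace IsCoveringGraph

variable {T : Type*} {π : T → V} {E : T → T → Prop}

variable (X π E) in
/-- `s` is a section of the covering graph over the cube `C`. -/
def IsSectionOn (C : Set V) (s : V → T) : Prop :=
  (∀ v ∈ C, π (s v) = v) ∧ ∀ v ∈ C, ∀ w ∈ C, X.Adj v w → E (s v) (s w)

theorem IsSectionOn.mono {C D : Set V} {s : V → T} (h : IsSectionOn X π E C s) (hD : D ⊆ C) :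
    IsSectionOn X π E D s :=
  ⟨fun v hv => h.1 v (hD hv), fun v hv w hw => h.2 v (hD hv) w (hD hw)⟩

/-- Unique lifting of edges identifies `y`, `y'` and then `z` with the corners of the lifted square
at `x`. -/
theorem square_lift (hE : X.IsCoveringGraph π E) {x y z y' : T} (h1 : E x y) (h2 : E y z)
    (h3 : E x y') (hs : X.Square (π x) (π y) (π z) (π y')) : E y' z := by
  obtain ⟨u, u', t, hu, hu', ht, e1, e2, e3, e4⟩ := hE.exists_square x hs
  obtain rfl := hE.unique h1 e1 hu.symm
  obtain rfl := hE.unique h3 e2 hu'.symm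
  obtain rfl := hE.unique h2 e3 ht.symm
  exact e4

/-- Equality spreads along the edges of the cube by unique lifting. -/
theorem IsSectionOn.eq_of_eq (hE : X.IsCoveringGraph π E) {C : Set V} (hC : C ∈ X.cubes)
    {s s' : V → T} (h : IsSectionOn X π E C s) (h' : IsSectionOn X π E C s') {v w : V}
    (hv : v ∈ C) (hw : w ∈ C) (he : s v = s' v) : s w = s' w := by
  obtain ⟨n, φ, hφ⟩ := X.exists_chart C hC
  obtain ⟨ε, rfl⟩ := hφ.exists_eq hv
  obtain ⟨δ, rfl⟩ := hφ.exists_eq hw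
  refine flipAt_induction (p := fun δ => s (φ δ) = s' (φ δ)) he (fun δ i hδ => ?_) δ
  have e1 := h.2 _ (hφ.mem δ) _ (hφ.mem (flipAt δ i)) (adj_flipAt hφ δ i)
  have e2 := h'.2 _ (hφ.mem δ) _ (hφ.mem (flipAt δ i)) (adj_flipAt hφ δ i)
  rw [hδ] at e1
  exact hE.unique e1 e2 ((h.1 _ (hφ.mem _)).trans (h'.1 _ (hφ.mem _)).symm)

/-- The section is built on the faces through the base vertex `ε`, adding one free coordinate `j` at
a time. The new half is lifted from the old one along the edges in direction `j`; its own edges then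
lift by `square_lift`. -/
theorem exists_isSectionOn (hE : X.IsCoveringGraph π E) {C : Set V} (hC : C ∈ X.cubes) (x : T)
    (hx : π x ∈ C) : ∃ s, IsSectionOn X π E C s ∧ s (π x) = x := by
  classical
  obtain ⟨n, φ, hφ⟩ := X.exists_chart C hC
  obtain ⟨ε, hε⟩ := hφ.exists_eq hx
  have key : ∀ S : Finset (Fin n), ∃ s : (Fin n → Bool) → T, s ε = x ∧
      (∀ δ, (∀ i ∉ S, δ i = ε i) → π (s δ) = φ δ) ∧
      ∀ δ, (∀ i ∉ S, δ i = ε i) → ∀ i ∈ S, E (s δ) (s (flipAt δ i)) := by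
    intro S
    induction S using Finset.induction_on with
    | empty =>
      refine ⟨fun _ => x, rfl, fun δ h => ?_, fun _ _ i hi => absurd hi (by simp)⟩
      rw [show δ = ε from funext fun i => h i (by simp), hε]
    | insert j S hj ih =>
      obtain ⟨s, hs, hπ, hs'⟩ := ih
      choose! m hm using fun (x : T) (w : V) (h : X.Adj (π x) w) => hE.exists_lift x h
      set s' : (Fin n → Bool) → T :=
        fun δ => if δ j = ε j then s δ else m (s (flipAt δ j)) (φ δ) with hs'def
      have hon : ∀ δ : Fin n → Bool, (∀ i ∉ insert j S, δ i = ε i) → δ j = ε j →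
          ∀ i ∉ S, δ i = ε i := fun δ h hδ i hi => by
        by_cases hij : i = j
        · rw [hij, hδ]
        · exact h i (by simp [hij, hi])
      have hoff : ∀ δ : Fin n → Bool, (∀ i ∉ insert j S, δ i = ε i) → δ j ≠ ε j →
          ∀ i ∉ S, flipAt δ j i = ε i := fun δ h hδ i hi => by
        by_cases hij : i = j
        · rw [hij, flipAt_same]; exact Bool.not_eq.mpr hδ
        · rw [flipAt_of_ne _ hij]; exact h i (by simp [hij, hi])
      have hpos : ∀ δ, δ j = ε j → s' δ = s δ := fun δ h => if_pos h
      have hneg : ∀ δ, (∀ i ∉ insert j S, δ i = ε i) → δ j ≠ ε j →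
          π (s' δ) = φ δ ∧ E (s (flipAt δ j)) (s' δ) := fun δ h hδ => by
        rw [show s' δ = m (s (flipAt δ j)) (φ δ) from if_neg hδ]
        refine hm _ _ ?_
        rw [hπ _ (hoff δ h hδ)]
        exact (adj_flipAt hφ δ j).symm
      have hπ' : ∀ δ, (∀ i ∉ insert j S, δ i = ε i) → π (s' δ) = φ δ := fun δ h => by
        by_cases hδ : δ j = ε j
        · rw [hpos δ hδ]; exact hπ δ (hon δ h hδ)
        · exact (hneg δ h hδ).1
      refine ⟨s', (hpos ε rfl).trans hs, hπ', fun δ h i hi => ?_⟩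
      have hflip : ∀ k ∉ insert j S, flipAt δ i k = ε k := fun k hk => by
        rw [flipAt_of_ne _ (by rintro rfl; exact hk hi)]; exact h k hk
      by_cases hij : i = j
      · subst hij
        by_cases hδ : δ i = ε i
        · have h1 : flipAt δ i i ≠ ε i := by rw [flipAt_same, hδ]; simp
          have := (hneg _ hflip h1).2
          rwa [flipAt_flipAt, ← hpos δ hδ] at this
        · have h1 : flipAt δ i i = ε i := by rw [flipAt_same]; exact Bool.not_eq.mpr hδ
          rw [hpos _ h1]
          exact hE.symm (hneg δ h hδ).2
      · have hiS : i ∈ S := (Finset.mem_insert.1 hi).resolve_left hij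
        by_cases hδ : δ j = ε j
        · rw [hpos δ hδ, hpos _ (by rw [flipAt_of_ne _ (Ne.symm hij), hδ])]
          exact hs' δ (hon δ h hδ) i hiS
        · have hδ' : flipAt δ i j ≠ ε j := by rwa [flipAt_of_ne _ (Ne.symm hij)]
          have e1 := (hneg δ h hδ).2
          have e2 := (hneg _ hflip hδ').2
          have e3 := hs' _ (hoff δ h hδ) i hiS
          rw [flipAt_comm] at e2
          refine square_lift hE e3 e2 e1 ?_
          rw [hπ _ (hoff δ h hδ), hπ' _ h, hπ' _ hflip, flipAt_comm δ, ← flipAt_comm δ,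
            hπ _ (by rw [flipAt_comm]; exact hoff _ hflip hδ')]
          have := square_flipAt hφ (flipAt δ j) hij
          rwa [flipAt_comm (flipAt δ j), flipAt_flipAt] at this
  obtain ⟨s, hs, hπ, hs'⟩ := key Finset.univ
  have hinv : ∀ δ, (fun v => s (Function.invFun φ v)) (φ δ) = s δ := fun δ =>
    congrArg s (Function.leftInverse_invFun hφ.1 δ)
  refine ⟨fun v => s (Function.invFun φ v), ⟨fun v hv => ?_, fun v hv w hw hadj => ?_⟩, ?_⟩
  · obtain ⟨δ, rfl⟩ := hφ.exists_eq hv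
    rw [hinv, hπ δ (by simp)]
  · obtain ⟨δ, rfl⟩ := hφ.exists_eq hv
    obtain ⟨i, rfl⟩ := exists_eq_flipAt hφ hw hadj
    rw [hinv, hinv]
    exact hs' δ (by simp) i (by simp)
  · rw [← hε, hinv, hs]

/-- The covering graph is trivial over each cube, compatibly with intersections of cubes. -/
theorem exists_transport (hE : X.IsCoveringGraph π E) : ∃ tr : T → V → T,
    ∀ x, ∀ C ∈ X.cubes, π x ∈ C → IsSectionOn X π E C (tr x) ∧ tr x (π x) = x := by
  classical
  rcases isEmpty_or_nonempty T with hT | hT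
  · exact ⟨fun x => isEmptyElim x, fun x => isEmptyElim x⟩
  choose! σ hσ hσ' using fun (C : Set V) (hC : C ∈ X.cubes) (x : T) (hx : π x ∈ C) =>
    exists_isSectionOn hE hC x hx
  choose! D hD using fun (x : T) (w : V) (h : ∃ D ∈ X.cubes, π x ∈ D ∧ w ∈ D) => h
  -- The value at `w` uses an arbitrary cube `D x w` containing `π x` and `w`. Another choice gives
  -- the same value, because the two cubes meet in a cube and both sections pass through `x`.
  have key : ∀ x, ∀ C ∈ X.cubes, π x ∈ C → ∀ w ∈ C, σ (D x w) x w = σ C x w := by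
    intro x C hC hx w hw
    obtain ⟨h1, h2, h3⟩ := hD x w ⟨C, hC, hx, hw⟩
    have hI := X.inter_mem _ h1 C hC ⟨π x, h2, hx⟩
    exact IsSectionOn.eq_of_eq hE hI ((hσ _ h1 x h2).mono Set.inter_subset_left)
      ((hσ C hC x hx).mono Set.inter_subset_right) ⟨h2, hx⟩ ⟨h3, hw⟩
      ((hσ' _ h1 x h2).trans (hσ' C hC x hx).symm)
  refine ⟨fun x w => σ (D x w) x w, fun x C hC hx => ⟨⟨fun v hv => ?_, fun v hv w hw hadj => ?_⟩,
    ?_⟩⟩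
  · dsimp only
    rw [key x C hC hx v hv]; exact (hσ C hC x hx).1 v hv
  · dsimp only
    rw [key x C hC hx v hv, key x C hC hx w hw]; exact (hσ C hC x hx).2 v hv w hw hadj
  · dsimp only
    rw [key x C hC hx _ hx]; exact hσ' C hC x hx

end IsCoveringGraph

end CubeComplex

/-! ### From a covering graph to a covering space of the realization -/

open Topology unitInterval

section cubePoint

variable {V : Type*} {n : ℕ} (φ : (Fin n → Bool) → V)

theorem cubePoint_apply_eq_zero (t : Fin n → ℝ) {v : V} (hv : v ∉ Set.range φ) :
    cubePoint φ t v = 0 := by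
  refine Finset.sum_eq_zero fun ε _ => Set.indicator_of_notMem ?_ _
  rintro rfl
  exact hv ⟨ε, rfl⟩

theorem exists_cubePoint_apply_ne_zero {φ : (Fin n → Bool) → V} (hφ : Function.Injective φ)
    (t : Fin n → ℝ) : ∃ ε, cubePoint φ t (φ ε) ≠ 0 := by
  classical
  -- At this vertex each factor of the weight is `t i` if that is nonzero, and `1 - 0` otherwise.
  refine ⟨fun i => decide (t i ≠ 0), ?_⟩
  rw [cubePoint, Finset.sum_eq_single (fun i => decide (t i ≠ 0))]
  · rw [Set.indicator_apply, if_pos (Set.mem_singleton _)]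
    refine Finset.prod_ne_zero_iff.2 fun i _ => ?_
    by_cases h : t i = 0 <;> simp [h]
  · intro ε _ hε
    refine Set.indicator_of_notMem ?_ _
    exact fun h => hε (hφ h).symm
  · simp

theorem cubePoint_vertex (ε : Fin n → Bool) :
    cubePoint φ (fun i => if ε i = true then 1 else 0) = Set.indicator {φ ε} 1 := by
  classical
  funext v
  rw [cubePoint, Finset.sum_eq_single ε]
  · congr 1
    funext _
    refine Finset.prod_eq_one fun i _ => ?_
    by_cases h : ε i = true <;> simp [h]
  · intro δ _ hδ
    obtain ⟨i, hi⟩ := Function.ne_iff.1 hδ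
    refine Set.indicator_apply_eq_zero.2 fun _ => Finset.prod_eq_zero (Finset.mem_univ i) ?_
    cases h1 : δ i <;> cases h2 : ε i <;> simp_all
  · simp

theorem continuous_cubePoint : Continuous (cubePoint φ) := by
  refine continuous_pi fun v => continuous_finsetSum _ fun ε _ => ?_
  by_cases h : v ∈ ({φ ε} : Set V)
  · simp only [Set.indicator_of_mem h]
    refine continuous_finsetProd _ fun i _ => ?_
    split_ifs <;> fun_prop
  · simp only [Set.indicator_of_notMem h]
    exact continuous_const

end cubePoint

namespace CubeComplex

variable {V : Type*} {X : CubeComplex V}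

theorem exists_support {p : V → ℝ} (hp : p ∈ X.realization) :
    ∃ C ∈ X.cubes, (∀ v, p v ≠ 0 → v ∈ C) ∧ ∃ v, p v ≠ 0 := by
  obtain ⟨C, n, φ, t, hφ, -, rfl⟩ := hp
  refine ⟨C.1, C.2, fun v hv => ?_, ?_⟩
  · rw [← hφ.2.1]
    by_contra h
    exact hv (cubePoint_apply_eq_zero φ t h)
  · obtain ⟨ε, hε⟩ := exists_cubePoint_apply_ne_zero hφ.1 t
    exact ⟨_, hε⟩

variable (X) in
/-- A vertex, as a point of the geometric realization. -/
noncomputable def vertexPoint (v : V) : X.realization :=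
  ⟨Set.indicator {v} 1, by
    obtain ⟨n, φ, hφ⟩ := X.exists_chart _ (X.singleton_mem v)
    have ε : Fin n → Bool := fun _ => true
    refine ⟨X.vertexCube v, n, φ, fun i => if ε i = true then 1 else 0, hφ, fun i => ?_, ?_⟩
    · dsimp only
      split_ifs <;> simp
    · rw [cubePoint_vertex, show φ ε = v from hφ.mem ε]⟩

/-- Two vertices of a cube are joined by a path in the realization of the cube. -/
theorem exists_path {C : Set V} (hC : C ∈ X.cubes) {v w : V} (hv : v ∈ C) (hw : w ∈ C) :
    ∃ γ : Path (X.vertexPoint v) (X.vertexPoint w), ∀ t u, (γ t).1 u ≠ 0 → u ∈ C := by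
  obtain ⟨n, φ, hφ⟩ := X.exists_chart C hC
  obtain ⟨ε, rfl⟩ := hφ.exists_eq hv
  obtain ⟨δ, rfl⟩ := hφ.exists_eq hw
  let c : I → Fin n → ℝ := fun s i =>
    (1 - s.1) * (if ε i = true then 1 else 0) + s.1 * (if δ i = true then 1 else 0)
  have hc : Continuous c := by
    refine continuous_pi fun i => ?_
    dsimp only [c]
    fun_prop
  have hmem : ∀ s, cubePoint φ (c s) ∈ X.realization := fun s => by
    refine ⟨⟨C, hC⟩, n, φ, c s, hφ, fun i => ?_, rfl⟩
    have h0 := s.2.1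
    have h1 := s.2.2
    dsimp only [c]
    constructor <;> split_ifs <;> linarith
  refine ⟨⟨⟨fun s => ⟨cubePoint φ (c s), hmem s⟩, ?_⟩, ?_, ?_⟩, fun s u hu => ?_⟩
  · exact ((continuous_cubePoint φ).comp hc).subtype_mk _
  · refine Subtype.ext ?_
    show cubePoint φ (c 0) = Set.indicator {φ ε} 1
    rw [← cubePoint_vertex]
    congr 1
    funext i
    simp [c]
  · refine Subtype.ext ?_
    show cubePoint φ (c 1) = Set.indicator {φ δ} 1
    rw [← cubePoint_vertex]
    congr 1
    funext i
    simp [c]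
  · rw [← hφ.2.1]
    by_contra h
    exact hu (cubePoint_apply_eq_zero φ _ h)

namespace IsCoveringGraph

variable {T : Type*} {π : T → V} {E : T → T → Prop}

variable (X π E) in
/-- `tr x` is a section of the covering graph through `x` over each cube at `π x`. -/
def IsTransport (tr : T → V → T) : Prop :=
  ∀ x, ∀ C ∈ X.cubes, π x ∈ C → IsSectionOn X π E C (tr x) ∧ tr x (π x) = x

open Classical in
variable (π) in
/-- The lift of a point of the realization along the section through `x`. -/
noncomputable def liftPoint (tr : T → V → T) (x : T) (p : V → ℝ) : T → ℝ :=
  fun y => if y = tr x (π y) then p (π y) else 0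

variable (X π) in
/-- The covering space of the realization determined by a covering graph. -/
def CoveringSpace (tr : T → V → T) : Type _ :=
  {e : X.realization × (T → ℝ) // ∃ x, e.1.1 (π x) ≠ 0 ∧ e.2 = liftPoint π tr x e.1.1}

instance (tr : T → V → T) : TopologicalSpace (CoveringSpace X π tr) :=
  instTopologicalSpaceSubtype

/-- The projection of the covering space. -/
def proj (tr : T → V → T) : CoveringSpace X π tr → X.realization := fun e => e.1.1

variable {tr : T → V → T}

/-- The sections through `x` and through `tr x v` agree on `C`, and coordinates outside `C` vanish.
So a lifted point does not depend on which vertex of the sheet over `C` names it. -/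
theorem liftPoint_transport (hE : X.IsCoveringGraph π E) (htr : IsTransport X π E tr) {C : Set V}
    (hC : C ∈ X.cubes) {x : T} (hx : π x ∈ C) {v : V} (hv : v ∈ C) {p : V → ℝ}
    (hp : ∀ v, p v ≠ 0 → v ∈ C) : liftPoint π tr (tr x v) p = liftPoint π tr x p := by
  funext z
  by_cases hz : p (π z) = 0
  · simp [liftPoint, hz]
  have hπ := (htr x C hC hx).1.1 v hv
  have : tr (tr x v) (π z) = tr x (π z) := by
    have h1 := htr (tr x v) C hC (by rwa [hπ])
    refine IsSectionOn.eq_of_eq hE hC h1.1 (htr x C hC hx).1 hv (hp _ hz) ?_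
    have h2 := h1.2
    rwa [hπ] at h2
  rw [liftPoint, liftPoint, this]

theorem liftPoint_apply_self (htr : IsTransport X π E tr) (x : T) (p : V → ℝ) :
    liftPoint π tr x p x = p (π x) :=
  if_pos (htr x _ (X.singleton_mem _) rfl).2.symm

theorem eq_of_liftPoint_apply_ne_zero (htr : IsTransport X π E tr) {x y : T} (hxy : π x = π y)
    {p : V → ℝ} (h : liftPoint π tr x p y ≠ 0) : y = x := by
  by_contra hne
  refine h (if_neg ?_)
  rwa [← hxy, (htr x _ (X.singleton_mem _) rfl).2]

theorem continuous_liftPoint (tr : T → V → T) (x : T) : Continuous (liftPoint π tr x) := by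
  refine continuous_pi fun y => ?_
  unfold liftPoint
  split_ifs
  · exact continuous_apply _
  · exact continuous_const

/-- Over the open star of `v`, points of the covering space are lifted from vertices over `v`. -/
theorem exists_eq_liftPoint (hE : X.IsCoveringGraph π E) (htr : IsTransport X π E tr)
    (e : CoveringSpace X π tr) {v : V} (hv : e.1.1.1 v ≠ 0) :
    ∃ x, π x = v ∧ e.1.2 = liftPoint π tr x e.1.1.1 := by
  obtain ⟨⟨p, q⟩, x, hx, hq⟩ := e
  dsimp at hx hq hv ⊢
  obtain ⟨C, hC, hsupp, -⟩ := exists_support p.2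
  refine ⟨tr x v, (htr x C hC (hsupp _ hx)).1.1 v (hsupp _ hv), ?_⟩
  rw [liftPoint_transport hE htr hC (hsupp _ hx) (hsupp _ hv) hsupp, hq]

/-- The open star of `v`, where the coordinate at `v` is nonzero, is evenly covered: its sheets are
indexed by the fibre of `π` over `v`. -/
theorem isCoveringMap_proj (hE : X.IsCoveringGraph π E) (htr : IsTransport X π E tr) :
    IsCoveringMap (proj (X := X) (π := π) tr) := by
  intro p₀
  suffices h : ∃ (F : Type _) (_ : TopologicalSpace F), IsEvenlyCovered (proj (X := X) (π := π) tr) p₀ F by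
    obtain ⟨F, _, h⟩ := h
    exact h.to_isEvenlyCovered_preimage
  obtain ⟨-, -, -, v, hv⟩ := exists_support p₀.2
  let _ : TopologicalSpace {x : T // π x = v} := ⊥
  have : DiscreteTopology {x : T // π x = v} := ⟨rfl⟩
  have hcont : Continuous (proj (X := X) (π := π) tr) := continuous_fst.comp continuous_subtype_val
  have hsnd : Continuous fun e : CoveringSpace X π tr => e.1.2 :=
    continuous_snd.comp continuous_subtype_val
  have hU : IsOpen {p : X.realization | p.1 v ≠ 0} :=
    isOpen_ne.preimage ((continuous_apply v).comp continuous_subtype_val)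
  refine ⟨{x : T // π x = v}, ⊥, inferInstance, {p | p.1 v ≠ 0}, hv, hU, hU.preimage hcont, ?_⟩
  choose g hg hg' using fun e : proj (X := X) (π := π) tr ⁻¹' {p | p.1 v ≠ 0} =>
    exists_eq_liftPoint hE htr e.1 e.2
  -- The sheet of `e` is read off from its coordinates: over the star of `v`, exactly one coordinate
  -- indexed by the fibre is nonzero. Hence the sheet index is locally constant.
  have hgiff : ∀ e (x : {x : T // π x = v}), e.1.1.2 x.1 ≠ 0 ↔ g e = x.1 := fun e x => by
    rw [hg' e]
    constructor
    · intro h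
      exact (eq_of_liftPoint_apply_ne_zero htr ((hg e).trans x.2.symm) h).symm
    · rintro h
      rw [← h, liftPoint_apply_self htr, hg e]
      exact e.2
  refine ⟨⟨⟨fun e => (⟨proj tr e.1, e.2⟩, ⟨g e, hg e⟩),
    fun y => ⟨⟨(y.1.1, liftPoint π tr y.2.1 y.1.1.1), y.2.1, by rw [y.2.2]; exact y.1.2, rfl⟩,
      y.1.2⟩, ?_, ?_⟩, ?_, ?_⟩, fun e => rfl⟩
  · intro e
    exact Subtype.ext (Subtype.ext (Prod.ext rfl (hg' e).symm))
  · intro y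
    refine Prod.ext rfl (Subtype.ext ?_)
    refine (hgiff _ _).1 ?_
    show liftPoint π tr y.2.1 y.1.1.1 y.2.1 ≠ 0
    rw [liftPoint_apply_self htr, y.2.2]
    exact y.1.2
  · refine (Continuous.subtype_mk (hcont.comp continuous_subtype_val) _).prodMk ?_
    rw [continuous_discrete_rng]
    intro x
    have : (fun e => (⟨g e, hg e⟩ : {x : T // π x = v})) ⁻¹' {x} = {e | e.1.1.2 x.1 ≠ 0} := by
      ext e
      rw [Set.mem_ofPred_eq, hgiff e x, Set.mem_preimage, Set.mem_singleton_iff, Subtype.ext_iff]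
    rw [this]
    exact isOpen_ne.preimage ((continuous_apply x.1).comp (hsnd.comp continuous_subtype_val))
  · rw [continuous_prod_of_discrete_right]
    intro x
    refine Continuous.subtype_mk (Continuous.subtype_mk ?_ _) _
    exact continuous_subtype_val.prodMk ((continuous_liftPoint tr x.1).comp
      (continuous_subtype_val.comp continuous_subtype_val))

end IsCoveringGraph

end CubeComplex

/-! ### Simple connectivity and global sections -/

/-- In a covering of a simply connected space, each fibre meets each path component at most once. -/
theorem IsCoveringMap.eq_of_joined {E B : Type*} [TopologicalSpace E] [TopologicalSpace B]
    [SimplyConnectedSpace B] {f : E → B} (hf : IsCoveringMap f) {x y : E} (h : Joined x y)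
    (hxy : f x = f y) : x = y := by
  obtain ⟨γ⟩ := h
  have h1 : (γ : C(I, E)) = hf.liftPath (γ.map hf.continuous) x (by simp) :=
    (hf.eq_liftPath_iff' _).2 ⟨rfl, γ.source⟩
  have h2 := hf.liftPath_apply_one_eq_of_homotopicRel
    (SimplyConnectedSpace.paths_homotopic (γ.map hf.continuous) ((Path.refl (f x)).cast rfl hxy.symm)) x
    (by simp) (by simp)
  have h3 : hf.liftPath ((Path.refl (f x)).cast rfl hxy.symm : Path _ _) x (by simp) = .const I x :=
    hf.liftPath_const rfl
  have h4 : γ 1 = x := (DFunLike.congr_fun h1 1).trans (h2.trans (DFunLike.congr_fun h3 1))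
  exact h4.symm.trans γ.target

namespace CubeComplex.IsCoveringGraph

variable {V : Type*} {X : CubeComplex V} {T : Type*} {π : T → V} {E : T → T → Prop}

/-- A covering of the `1`-skeleton of a simply connected cube complex along which squares lift has
a section through each vertex. -/
theorem exists_section [SimplyConnectedSpace X.realization] (hE : X.IsCoveringGraph π E) (x₀ : T) :
    ∃ s : V → T, (∀ v, π (s v) = v) ∧ (∀ v w, X.Adj v w → E (s v) (s w)) ∧ s (π x₀) = x₀ := by
  obtain ⟨tr, htr⟩ := hE.exists_transport
  have hcov := isCoveringMap_proj hE htr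
  have hvp : ∀ v, (X.vertexPoint v).1 v ≠ 0 := fun v => by simp [vertexPoint]
  let pt : T → CoveringSpace X π tr := fun x =>
    ⟨(X.vertexPoint (π x), liftPoint π tr x (X.vertexPoint (π x)).1), x, hvp _, rfl⟩
  have hpt : ∀ v (e : CoveringSpace X π tr), proj tr e = X.vertexPoint v →
      ∃ x, π x = v ∧ e = pt x := by
    intro v e he
    obtain ⟨x, rfl, hx⟩ := exists_eq_liftPoint hE htr e (v := v)
      (by rw [show e.1.1 = X.vertexPoint v from he]; exact hvp v)
    refine ⟨x, rfl, Subtype.ext (Prod.ext he ?_)⟩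
    rw [hx, show e.1.1 = X.vertexPoint (π x) from he]
  have hinj : ∀ x y, pt x = pt y → π x = π y → x = y := by
    intro x y he hxy
    have h2 : liftPoint π tr x (X.vertexPoint (π x)).1 = liftPoint π tr y (X.vertexPoint (π y)).1 :=
      congrArg (fun e => e.1.2) he
    refine eq_of_liftPoint_apply_ne_zero htr hxy.symm (p := (X.vertexPoint (π y)).1) ?_
    rw [← h2, liftPoint_apply_self htr]
    exact hvp _
  -- The section at `v` is the end of a lift, starting at `pt x₀`, of any path to `v` in the
  -- realization.
  have hjoin : ∀ v, ∃ x, π x = v ∧ Joined (pt x₀) (pt x) := by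
    intro v
    obtain ⟨γ⟩ := PathConnectedSpace.joined (X.vertexPoint (π x₀)) (X.vertexPoint v)
    have h0 : γ 0 = proj tr (pt x₀) := γ.source
    obtain ⟨x, hx, hx'⟩ := hpt v (hcov.liftPath γ (pt x₀) h0 1) 
      ((congrFun (hcov.liftPath_lifts γ (pt x₀) h0) 1).trans γ.target)
    exact ⟨x, hx, ⟨⟨hcov.liftPath γ (pt x₀) h0, hcov.liftPath_zero .., hx'⟩⟩⟩
  choose s hs hs' using hjoin
  refine ⟨s, hs, fun v w hadj => ?_, ?_⟩
  · have hv : π (s v) ∈ ({v, w} : Set V) := by rw [hs]; simp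
    have hw : w ∈ ({v, w} : Set V) := by simp
    have hsec := htr (s v) _ hadj.2 hv
    obtain ⟨γ, hγ⟩ := exists_path hadj.2 hv hw
    have hmem : ∀ t, ∃ x, (γ t).1 (π x) ≠ 0 ∧
        liftPoint π tr (s v) (γ t).1 = liftPoint π tr x (γ t).1 := fun t => by
      obtain ⟨-, -, -, u, hu⟩ := exists_support (γ t).2
      refine ⟨tr (s v) u, ?_, (liftPoint_transport hE htr hadj.2 hv (hγ t u hu) (hγ t)).symm⟩
      rwa [hsec.1.1 u (hγ t u hu)]
    have hπw : π (tr (s v) w) = w := hsec.1.1 w hw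
    -- The path along the edge lifts within the sheet of `s v`. Its end and `pt (s w)` lie over the
    -- same vertex in one path component, so they coincide.
    have hΓ : Joined (pt (s v)) (pt (tr (s v) w)) := by
      refine ⟨⟨⟨fun t => ⟨(γ t, liftPoint π tr (s v) (γ t).1), hmem t⟩, ?_⟩, ?_, ?_⟩⟩
      · exact Continuous.subtype_mk (γ.continuous.prodMk ((continuous_liftPoint tr _).comp
          (continuous_subtype_val.comp γ.continuous))) _
      · refine Subtype.ext ?_
        show (γ 0, liftPoint π tr (s v) (γ 0).1) = _
        rw [γ.source]
      · refine Subtype.ext ?_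
        show (γ 1, liftPoint π tr (s v) (γ 1).1) = _
        have := liftPoint_transport hE htr hadj.2 hv hw (hγ 1)
        rw [← this, γ.target]
        show _ = (X.vertexPoint (π (tr (s v) w)), liftPoint π tr _ (X.vertexPoint (π (tr (s v) w))).1)
        rw [hπw]
    have hj := ((hs' w).symm.trans (hs' v)).trans hΓ
    have heq : s w = tr (s v) w := hinj _ _ (hcov.eq_of_joined hj (by
      show X.vertexPoint _ = X.vertexPoint _
      rw [hs, hπw])) ((hs w).trans hπw.symm)
    have := hsec.1.2 v (by simp) w hw hadj
    rw [heq]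
    have h2 := hsec.2
    rw [hs] at h2
    rwa [h2] at this
  · exact (hinj _ _ (hcov.eq_of_joined (hs' (π x₀)) (by
      show X.vertexPoint _ = X.vertexPoint _
      rw [hs])) (hs _).symm).symm

end CubeComplex.IsCoveringGraph

/-! ### The cubical distance -/

namespace CubeComplex

variable {V : Type*} (X : CubeComplex V)

/-- The combinatorial properties of the distance `d v P` from `v` to `P` in a `CAT(0)` cube
complex. -/
structure IsCubicalDist (d : V → V → ℕ) : Prop where
  eq_zero_iff : ∀ v P, d v P = 0 ↔ v = P
  adj : ∀ P {v w}, X.Adj v w → d w P = d v P + 1 ∨ d v P = d w P + 1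
  exists_adj : ∀ {v P}, v ≠ P → ∃ a, X.Adj v a ∧ d v P = d a P + 1
  exists_square : ∀ {v a b P}, a ≠ b → X.Adj v a → X.Adj v b → d v P = d a P + 1 →
    d v P = d b P + 1 → ∃ c, X.Square v a c b ∧ d a P = d c P + 1

variable {X}

/-- In a simply connected complex with flag links, there is exactly one class of reduced edge paths
between two vertices. -/
theorem exists_isReduced [SimplyConnectedSpace X.realization] (hflag : ∀ v, X.IsFlagLink v)
    (P v : V) : ∃ w, X.IsReduced v w ∧ w.getLastD v = P ∧
      ∀ w', X.IsReduced v w' → w'.getLastD v = P → X.SwapEquiv v w w' := by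
  have hcov := ReducedClass.isCoveringGraph hflag P
  obtain ⟨s, hs, hadj, h0⟩ := hcov.exists_section
    (ReducedClass.mk (IsReduced.nil P) rfl : X.ReducedClass P)
  -- Every reduced path to `P` represents the value of the section: this holds for the empty path,
  -- and prepending an edge preserves it by unique lifting.
  have key : ∀ (w : List V) (v : V) (h : X.IsReduced v w) (hP : w.getLastD v = P),
      s v = ReducedClass.mk h hP := by
    intro w
    induction w with
    | nil =>
      intro v h hP
      obtain rfl : v = P := hP
      exact h0
    | cons a u ih =>
      intro v h hP
      have hP' : u.getLastD a = P := by rw [← hP, List.getLastD_cons]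
      have h1 := ih a h.tail hP'
      have h2 := (ReducedClass.isStep_mk h h.tail hP hP').symm
      rw [← h1] at h2
      exact hcov.unique (hadj a v h.refl.adj.symm) h2 (hs v)
  obtain ⟨v', w, hw, hP, he⟩ := ReducedClass.exists_rep (s v)
  obtain rfl : v' = v := by rw [← hs v, he]; rfl
  exact ⟨w, hw, hP, fun w' hw' hP' =>
    ReducedClass.swapEquiv_of_mk_eq_mk (he.symm.trans (key w' v' hw' hP'))⟩

/-- The distance is the length of a reduced path. Along an edge from `v` to `v'`, either the path at
`v` can be rewritten to start with `v'` and is shortened, or prepending `v` gives a reduced path at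
`v'`. Two shortening edges differ by a swap, whence the square. -/
theorem exists_isCubicalDist [SimplyConnectedSpace X.realization]
    (hflag : ∀ v, X.IsFlagLink v) : ∃ d, X.IsCubicalDist d := by
  choose w hw hP hu using exists_isReduced (X := X) hflag
  have hd : ∀ P v w', X.IsReduced v w' → w'.getLastD v = P → (w P v).length = w'.length :=
    fun P v w' h h' => (hu P v w' h h').length_eq
  have hstep : ∀ P {v v'}, X.Adj v v' →
      (∃ u, X.SwapEquiv v (w P v) (v' :: u)) ∧ (w P v).length = (w P v').length + 1 ∨
        (w P v').length = (w P v).length + 1 := by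
    intro P v v' hadj
    by_cases hex : ∃ u, X.SwapEquiv v (w P v) (v' :: u)
    · refine .inl ⟨hex, ?_⟩
      obtain ⟨u, hu⟩ := hex
      rw [hd P v' u ((hw P v).of_swapEquiv hflag hu).tail
        (by rw [← List.getLastD_cons, ← hu.getLastD_eq, hP]), hu.length_eq, List.length_cons]
    · right
      rw [hd P v' (v :: w P v) (.cons hadj.symm (hw P v) fun t ht => hex ⟨t, ht⟩)
        (by rw [List.getLastD_cons, hP]), List.length_cons]
  have hdesc : ∀ P {v a}, X.Adj v a → (w P v).length = (w P a).length + 1 →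
      ∃ u, X.SwapEquiv v (w P v) (a :: u) := by
    intro P v a hadj h
    rcases hstep P hadj with h' | h'
    · exact h'.1
    · omega
  refine ⟨fun v P => (w P v).length, fun v P => ?_, fun P v v' hadj => ?_, fun {v P} hne => ?_,
    fun {v a b P} hab ha hb hda hdb => ?_⟩
  · constructor
    · intro h
      have := hP P v
      rwa [List.length_eq_zero_iff.1 h] at this
    · rintro rfl
      exact hd v v [] (.nil v) rfl
  · rcases hstep P hadj with h | h
    · exact .inr h.2
    · exact .inl h
  · have h1 := hP P v
    have h2 := hw P v
    have h3 := hd P v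
    cases hwv : w P v with
    | nil => rw [hwv] at h1; exact absurd h1 hne
    | cons a u =>
      rw [hwv] at h1 h2
      refine ⟨a, h2.refl.adj, ?_⟩
      rw [List.getLastD_cons] at h1
      simp only [hd P a u h2.tail h1, List.length_cons]
  · obtain ⟨u, hu1⟩ := hdesc P ha hda
    obtain ⟨u', hu2⟩ := hdesc P hb hdb
    obtain ⟨c, t, hs, h1, -⟩ := (hu1.symm.trans hflag hu2).exists_square hab
    refine ⟨c, hs, ?_⟩
    have hra := ((hw P v).of_swapEquiv hflag hu1).tail
    have hrc := (hra.of_swapEquiv hflag h1).tail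
    have hPa : u.getLastD a = P := by rw [← List.getLastD_cons, ← hu1.getLastD_eq, hP]
    have hPc : t.getLastD c = P := by rw [← List.getLastD_cons, ← h1.getLastD_eq, hPa]
    simp only [hd P a u hra hPa, hd P c t hrc hPc, h1.length_eq, List.length_cons]

namespace IsCubicalDist

variable {d : V → V → ℕ}

/-- If no neighbour of `q` is closer to both `x` and `y`, then `q` lies on a geodesic from `x`
to `y`. -/
theorem eq_add (hd : X.IsCubicalDist d) {q x y : V}
    (h : ∀ a, X.Adj q a → d q x = d a x + 1 → d q y ≠ d a y + 1) : d x y = d q x + d q y := by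
  induction hk : d q x generalizing q with
  | zero =>
    obtain rfl := (hd.eq_zero_iff _ _).1 hk
    simp
  | succ k ih =>
    have hqx : q ≠ x := fun he => by rw [(hd.eq_zero_iff _ _).2 he] at hk; omega
    -- The neighbour `u` is nearer to `x` and farther from `y`, and it inherits the hypothesis: a
    -- neighbour of `u` nearer to both would, through a square, yield such a neighbour `b` of `q`.
    obtain ⟨u, hu, hux⟩ := hd.exists_adj hqx
    have huy := (hd.adj y hu).resolve_right (h u hu hux)
    rw [ih (q := u) ?_ (by omega)]
    · omega
    · intro a ha hax hay
      have hqa : q ≠ a := by rintro rfl; omega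
      obtain ⟨b, hs, hb⟩ := hd.exists_square hqa hu.symm ha huy hay
      refine h b hs.adj_left' ?_ hb
      have h1 := hd.adj x hs.adj_left'
      have h2 := hd.adj x hs.adj_right'
      omega

/-- Opposite edges of a square define the same halfspace. -/
theorem lt_of_square (hd : X.IsCubicalDist d) {u v v' u' x : V} (hs : X.Square u v v' u')
    (h : d u x < d v x) : d u' x < d v' x := by
  have h1 := hd.adj x hs.adj_left
  have h2 := hd.adj x hs.adj_right
  have h3 := hd.adj x hs.adj_left'
  have h4 := hd.adj x hs.adj_right'
  by_contra hlt
  -- Otherwise `u` and `v'` are both nearer to `x` than `v`. The fourth corner of their square must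
  -- be nearer still, but it is `u'`, which is farther than `v'`.
  obtain ⟨c, hc, hcd⟩ := hd.exists_square hs.ne' hs.adj_left.symm hs.adj_left' (P := x)
    (by omega) (by omega)
  obtain rfl := hs.rotate.reverse.unique hc
  omega

end IsCubicalDist

end CubeComplex

/-! ### Hyperplanes, separation and parallelism -/

namespace CubeComplex

variable {V : Type*} {X : CubeComplex V}

theorem exists_mem_adj {C : Set V} (hC : C ∈ X.cubes) {D : Set V} (hD : D ∈ X.cubes)
    (hDC : D ⊆ C) (hne : D ≠ C) {u : V} (hu : u ∈ D) : ∃ w ∈ C, X.Adj u w ∧ w ∉ D := by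
  by_contra! h
  obtain ⟨n, φ, hφ⟩ := X.exists_chart C hC
  obtain ⟨ε, rfl⟩ := hφ.exists_eq (hDC hu)
  exact hne (hφ.eq_of_forall_flipAt_mem hD hDC hu
    fun i => h _ (hφ.mem _) (adj_flipAt hφ ε i))

/-- A cube is determined by one of its vertices and the neighbours of that vertex in it. -/
theorem subset_of_forall_adj {C D : Set V} (hC : C ∈ X.cubes) (hD : D ∈ X.cubes) {u : V}
    (huC : u ∈ C) (huD : u ∈ D) (h : ∀ w ∈ C, X.Adj u w → w ∈ D) : C ⊆ D := by
  by_contra hsub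
  obtain ⟨w, hw, hadj, hw'⟩ := exists_mem_adj hC (X.inter_mem C hC D hD ⟨u, huC, huD⟩)
    Set.inter_subset_left (fun he => hsub (Set.inter_eq_left.1 he)) ⟨huC, huD⟩
  exact hw' ⟨hw, h w hw hadj⟩

/-- The edge `e` separates `x` from `y` with respect to the distance `d`: one of its ends is
closer to `x`, and the other one is closer to `y`. -/
def Separates (d : V → V → ℕ) (e : Sym2 V) (x y : V) : Prop :=
  ∃ u v, e = s(u, v) ∧ d u x < d v x ∧ d v y < d u y

theorem separates_mk {d : V → V → ℕ} {u v x y : V} : Separates d s(u, v) x y ↔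
    (d u x < d v x ∧ d v y < d u y) ∨ (d v x < d u x ∧ d u y < d v y) := by
  constructor
  · rintro ⟨u', v', he, h⟩
    rcases Sym2.eq_iff.1 he with ⟨rfl, rfl⟩ | ⟨rfl, rfl⟩
    · exact .inl h
    · exact .inr h
  · rintro (h | h)
    · exact ⟨u, v, rfl, h⟩
    · exact ⟨v, u, Sym2.eq_swap, h⟩

namespace IsCubicalDist

variable {d : V → V → ℕ} {n : ℕ} {φ : (Fin n → Bool) → V} {C : Set V} {ε δ : Fin n → Bool}
  {i : Fin n} {x : V}

/-- Flipping `j ≠ i` moves the edge across a square, which preserves its direction relative to `x`;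
flipping `i` swaps its ends. Hence the induction carries both values of `δ i`. -/
theorem lt_flipAt (hd : X.IsCubicalDist d) (hφ : IsCubeChart X.cubes φ C) (hδ : δ i = ε i)
    (h : d (φ ε) x < d (φ (flipAt ε i)) x) : d (φ δ) x < d (φ (flipAt δ i)) x := by
  suffices H : (δ i = ε i → d (φ δ) x < d (φ (flipAt δ i)) x) ∧
      (δ i ≠ ε i → d (φ (flipAt δ i)) x < d (φ δ) x) from H.1 hδ
  clear hδ
  refine flipAt_induction (p := fun δ => (δ i = ε i → d (φ δ) x < d (φ (flipAt δ i)) x) ∧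
    (δ i ≠ ε i → d (φ (flipAt δ i)) x < d (φ δ) x)) ⟨fun _ => h, fun h => absurd rfl h⟩
    (fun δ j ih => ?_) δ
  by_cases hij : i = j
  · subst hij
    rw [flipAt_same, flipAt_flipAt]
    refine ⟨fun h => ih.2 fun h' => ?_, fun h => ih.1 ?_⟩
    · rw [h'] at h; simp at h
    · by_contra h'
      exact h (Bool.not_eq.mpr h')
  · rw [flipAt_of_ne _ hij, flipAt_comm δ (i := j)]
    have hs := square_flipAt hφ δ hij
    exact ⟨fun h => hd.lt_of_square hs (ih.1 h),
      fun h => hd.lt_of_square hs.rotate.reverse (ih.2 h)⟩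

theorem flipAt_lt (hd : X.IsCubicalDist d) (hφ : IsCubeChart X.cubes φ C) (hδ : δ i = ε i)
    (h : d (φ (flipAt ε i)) x < d (φ ε) x) : d (φ (flipAt δ i)) x < d (φ δ) x := by
  have := hd.lt_flipAt hφ (ε := flipAt ε i) (δ := flipAt δ i) (i := i) (x := x)
    (by rw [flipAt_same, flipAt_same, hδ]) (by rwa [flipAt_flipAt])
  rwa [flipAt_flipAt] at this

/-- The parallel edge at `φ δ` has one end at distance zero from `φ δ`. -/
theorem lt_flipAt_of_eq (hd : X.IsCubicalDist d) (hφ : IsCubeChart X.cubes φ C) (hδ : δ i = ε i) :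
    d (φ ε) (φ δ) < d (φ (flipAt ε i)) (φ δ) := by
  refine hd.lt_flipAt hφ (ε := δ) hδ.symm ?_
  rw [(hd.eq_zero_iff _ _).2 rfl]
  refine Nat.pos_of_ne_zero fun h => ?_
  exact flipAt_ne_self δ (hφ.1 ((hd.eq_zero_iff _ _).1 h))

theorem flipAt_lt_of_ne (hd : X.IsCubicalDist d) (hφ : IsCubeChart X.cubes φ C) (hδ : δ i ≠ ε i) :
    d (φ (flipAt ε i)) (φ δ) < d (φ ε) (φ δ) := by
  have := hd.lt_flipAt_of_eq hφ (ε := flipAt ε i) (δ := δ) (i := i)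
    (by rw [flipAt_same]; exact Bool.eq_not.mpr hδ)
  rwa [flipAt_flipAt] at this

theorem separates_flipAt (hd : X.IsCubicalDist d) (hφ : IsCubeChart X.cubes φ C) {y : V}
    (h : Separates d s(φ ε, φ (flipAt ε i)) x y) : Separates d s(φ δ, φ (flipAt δ i)) x y := by
  rw [separates_mk] at h ⊢
  by_cases hδ : δ i = ε i
  · exact h.imp (fun h => ⟨hd.lt_flipAt hφ hδ h.1, hd.flipAt_lt hφ hδ h.2⟩)
      fun h => ⟨hd.flipAt_lt hφ hδ h.1, hd.lt_flipAt hφ hδ h.2⟩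
  · have hδ' : δ i = flipAt ε i i := by rw [flipAt_same]; exact Bool.eq_not.mpr hδ
    rw [← flipAt_flipAt ε (i := i), flipAt_flipAt (flipAt ε i)] at h
    rcases h with h | h
    · exact .inr ⟨hd.flipAt_lt hφ hδ' h.1, hd.lt_flipAt hφ hδ' h.2⟩
    · exact .inl ⟨hd.lt_flipAt hφ hδ' h.1, hd.flipAt_lt hφ hδ' h.2⟩

theorem separates_of_isMidplane (hd : X.IsCubicalDist d) {M : Set (Sym2 V)} (hM : X.IsMidplane M)
    {e f : Sym2 V} (he : e ∈ M) (hf : f ∈ M) {x y : V} (h : Separates d e x y) :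
    Separates d f x y := by
  obtain ⟨C, n, φ, hφ, i, rfl⟩ := hM
  obtain ⟨ε, rfl⟩ := he
  obtain ⟨δ, rfl⟩ := hf
  exact hd.separates_flipAt hφ h

end IsCubicalDist

theorem IsMidplane.nonempty {M : Set (Sym2 V)} (hM : X.IsMidplane M) : M.Nonempty := by
  obtain ⟨C, n, φ, hφ, i, rfl⟩ := hM
  exact ⟨_, fun _ => true, rfl⟩

theorem MidplaneEquiv.symm {M N : Set (Sym2 V)} (h : X.MidplaneEquiv M N) : X.MidplaneEquiv N M := by
  induction h with
  | refl => exact .refl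
  | tail _ h ih => exact .head ⟨h.2.1, h.1, by rw [Set.inter_comm]; exact h.2.2⟩ ih

theorem MidplaneEquiv.trans {M N K : Set (Sym2 V)} (h : X.MidplaneEquiv M N)
    (h' : X.MidplaneEquiv N K) : X.MidplaneEquiv M K :=
  Relation.ReflTransGen.trans h h'

theorem Adj.isMidplane {u v : V} (h : X.Adj u v) : X.IsMidplane {s(u, v)} := by
  obtain ⟨n, φ, hφ⟩ := X.exists_chart _ h.2
  obtain ⟨ε, hε⟩ := hφ.exists_eq (v := u) (by simp)
  obtain ⟨i, hi⟩ := exists_eq_flipAt hφ (w := v) (by simp) (by rwa [hε])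
  refine ⟨⟨_, h.2⟩, n, φ, hφ, i, Set.Subset.antisymm ?_ ?_⟩
  · rintro _ rfl
    exact ⟨ε, by rw [hi, ← hε]; rfl⟩
  · rintro _ ⟨δ, rfl⟩
    have h1 := hφ.mem δ
    have h2 := hφ.mem (flipAt δ i)
    have h3 := (adj_flipAt hφ δ i).1
    show s(φ δ, φ (flipAt δ i)) = s(u, v)
    rw [Sym2.eq_iff]
    simp only [Set.mem_insert_iff, Set.mem_singleton_iff] at h1 h2
    rcases h1 with h1 | h1 <;> rcases h2 with h2 | h2
    · exact absurd (h1.trans h2.symm) h3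
    · exact .inl ⟨h1, h2⟩
    · exact .inr ⟨h1, h2⟩
    · exact absurd (h1.trans h2.symm) h3

theorem IsMidplane.exists_adj {M : Set (Sym2 V)} (hM : X.IsMidplane M) {e : Sym2 V} (he : e ∈ M) :
    ∃ u v, X.Adj u v ∧ e = s(u, v) := by
  obtain ⟨C, n, φ, hφ, i, rfl⟩ := hM
  obtain ⟨ε, rfl⟩ := he
  exact ⟨_, _, adj_flipAt hφ ε i, rfl⟩

/-- Any edge of a midplane is itself a midplane meeting it in that edge. Hyperplanes are thus
determined by any one of their edges. -/
theorem IsMidplane.equiv_singleton {M : Set (Sym2 V)} (hM : X.IsMidplane M) {e : Sym2 V}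
    (he : e ∈ M) : X.MidplaneEquiv M {e} := by
  obtain ⟨u, v, hadj, rfl⟩ := hM.exists_adj he
  refine .single ⟨hM, hadj.isMidplane, ?_⟩
  rw [Set.inter_eq_right.2 (Set.singleton_subset_iff.2 he)]
  exact hadj.isMidplane

namespace IsHyperplane

variable {H H' : Set (Sym2 V)}

theorem exists_mem (u v : V) (h : X.Adj u v) : ∃ H, X.IsHyperplane H ∧ s(u, v) ∈ H :=
  ⟨_, ⟨{s(u, v)}, h.isMidplane, rfl⟩, {s(u, v)}, ⟨h.isMidplane, .refl⟩, rfl⟩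

theorem subset_of_mem (hH : X.IsHyperplane H) {M : Set (Sym2 V)} (hM : X.IsMidplane M)
    {e : Sym2 V} (heM : e ∈ M) (heH : e ∈ H) : M ⊆ H := by
  obtain ⟨M₀, hM₀, rfl⟩ := hH
  obtain ⟨N, ⟨hN, hMN⟩, heN⟩ := heH
  exact fun f hf => ⟨M, ⟨hM, (hMN.trans (hN.equiv_singleton heN)).trans
    (hM.equiv_singleton heM).symm⟩, hf⟩

theorem eq_of_mem (hH : X.IsHyperplane H) (hH' : X.IsHyperplane H') {e : Sym2 V}
    (he : e ∈ H) (he' : e ∈ H') : H = H' := by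
  suffices ∀ H H' : Set (Sym2 V), X.IsHyperplane H → X.IsHyperplane H' → e ∈ H → e ∈ H' →
      H ⊆ H' from (this H H' hH hH' he he').antisymm (this H' H hH' hH he' he)
  rintro _ _ ⟨M, hM, rfl⟩ ⟨M', hM', rfl⟩ ⟨N, ⟨hN, hMN⟩, heN⟩ ⟨N', ⟨hN', hMN'⟩, heN'⟩ f
    ⟨K, ⟨hK, hMK⟩, hfK⟩
  exact ⟨K, ⟨hK, (hMN'.trans (hN'.equiv_singleton heN')).trans
    ((hN.equiv_singleton heN).symm.trans (hMN.symm.trans hMK))⟩, hfK⟩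

/-- Consecutive midplanes of a chain share an edge, and within one midplane all edges are parallel
edges of a cube, so separation passes along the chain. -/
theorem separates {d : V → V → ℕ} (hd : X.IsCubicalDist d) (hH : X.IsHyperplane H) {e f : Sym2 V}
    (he : e ∈ H) (hf : f ∈ H) {x y : V} (h : Separates d e x y) : Separates d f x y := by
  obtain ⟨M, hM, rfl⟩ := hH
  obtain ⟨N, ⟨hN, hMN⟩, heN⟩ := he
  obtain ⟨N', ⟨hN', hMN'⟩, hfN'⟩ := hf
  have hNN' := hMN.symm.trans hMN'
  clear hMN hMN'
  induction hNN' generalizing f with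
  | refl => exact hd.separates_of_isMidplane hN heN hfN' h
  | tail _ hstep ih =>
    obtain ⟨g, hg⟩ := hstep.2.2.nonempty
    exact hd.separates_of_isMidplane hN' hg.2 hfN' (ih hg.1 hstep.1)

theorem flipAt_mem (hH : X.IsHyperplane H) {n : ℕ} {φ : (Fin n → Bool) → V} {C : Set V}
    (hφ : IsCubeChart X.cubes φ C) (hC : C ∈ X.cubes) {ε : Fin n → Bool} (δ : Fin n → Bool)
    {i : Fin n} (h : s(φ ε, φ (flipAt ε i)) ∈ H) : s(φ δ, φ (flipAt δ i)) ∈ H :=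
  hH.subset_of_mem ⟨⟨C, hC⟩, n, φ, hφ, i, rfl⟩ ⟨ε, rfl⟩ h ⟨δ, rfl⟩

theorem cuts_iff (hH : X.IsHyperplane H) (C : X.Cube) :
    X.Cuts H C ↔ ∃ u ∈ C.1, ∃ v ∈ C.1, X.Adj u v ∧ s(u, v) ∈ H := by
  constructor
  · rintro ⟨M, hMH, n, φ, hφ, i, rfl⟩
    exact ⟨_, hφ.mem fun _ => true, _, hφ.mem _, adj_flipAt hφ _ i, hMH ⟨fun _ => true, rfl⟩⟩
  · rintro ⟨u, hu, v, hv, hadj, huv⟩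
    obtain ⟨n, φ, hφ⟩ := X.exists_chart C.1 C.2
    obtain ⟨ε, rfl⟩ := hφ.exists_eq hu
    obtain ⟨i, rfl⟩ := exists_eq_flipAt hφ hv hadj
    exact ⟨_, hH.subset_of_mem ⟨C, n, φ, hφ, i, rfl⟩ ⟨ε, rfl⟩ huv, n, φ, hφ, i, rfl⟩

theorem exists_flipAt_mem (hH : X.IsHyperplane H) {C : X.Cube} (h : X.Cuts H C) {n : ℕ}
    {φ : (Fin n → Bool) → V} (hφ : IsCubeChart X.cubes φ C.1) :
    ∃ i, ∀ ε, s(φ ε, φ (flipAt ε i)) ∈ H := by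
  obtain ⟨u, hu, v, hv, hadj, huv⟩ := (hH.cuts_iff C).1 h
  obtain ⟨ε, rfl⟩ := hφ.exists_eq hu
  obtain ⟨i, rfl⟩ := exists_eq_flipAt hφ hv hadj
  exact ⟨i, fun δ => hH.flipAt_mem hφ C.2 δ huv⟩

theorem exists_adj_mem (hH : X.IsHyperplane H) {C : X.Cube} (h : X.Cuts H C) {u : V}
    (hu : u ∈ C.1) : ∃ v ∈ C.1, X.Adj u v ∧ s(u, v) ∈ H := by
  obtain ⟨n, φ, hφ⟩ := X.exists_chart C.1 C.2
  obtain ⟨ε, rfl⟩ := hφ.exists_eq hu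
  obtain ⟨i, hi⟩ := hH.exists_flipAt_mem h hφ
  exact ⟨_, hφ.mem _, adj_flipAt hφ ε i, hi ε⟩

end IsHyperplane

/-- A face of a cube, as a cube of the complex. -/
def _root_.IsCubeChart.face {n : ℕ} {φ : (Fin n → Bool) → V} {E : Set V}
    (hφ : IsCubeChart X.cubes φ E) (s : Finset (Fin n)) (a : Fin n → Bool) : X.Cube :=
  ⟨φ '' stdFace s a, hφ.image_mem s a⟩

variable (X) in
/-- The hyperplanes that cut a cube. -/
def cutSet (C : X.Cube) : Set (Set (Sym2 V)) := {H | X.IsHyperplane H ∧ X.Cuts H C}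

/-- A cube of dimension `n` is cut by exactly `n` hyperplanes. -/
theorem encard_cutSet {d : V → V → ℕ} (hd : X.IsCubicalDist d) {C : X.Cube} {n : ℕ}
    (hC : X.HasDim C n) : (X.cutSet C).encard = n := by
  obtain ⟨φ, hφ⟩ := hC
  have ε : Fin n → Bool := fun _ => true
  choose h hh hmem using fun i => IsHyperplane.exists_mem _ _ (adj_flipAt hφ ε i)
  have hinj : Function.Injective h := by
    intro i j hij
    by_contra hne
    -- The edge in direction `i` separates its own ends, while the edge in direction `j` has both of
    -- them on one side; so the two hyperplanes differ.
    have h1 : Separates d s(φ ε, φ (flipAt ε i)) (φ ε) (φ (flipAt ε i)) :=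
      separates_mk.2 (.inl ⟨hd.lt_flipAt_of_eq hφ rfl, hd.flipAt_lt_of_ne hφ (by simp)⟩)
    have h2 := (hh i).separates hd (hmem i) (hij ▸ hmem j) h1
    have h3 := hd.lt_flipAt_of_eq hφ (ε := ε) (δ := flipAt ε i) (i := j)
      (flipAt_of_ne _ (Ne.symm hne))
    have h4 := hd.lt_flipAt_of_eq hφ (ε := ε) (δ := ε) (i := j) rfl
    rw [separates_mk] at h2
    omega
  have hrange : X.cutSet C = Set.range h := by
    ext H
    constructor
    · rintro ⟨hH, hcut⟩
      obtain ⟨i, hi⟩ := hH.exists_flipAt_mem hcut hφ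
      exact ⟨i, (hh i).eq_of_mem hH (hmem i) (hi ε)⟩
    · rintro ⟨i, rfl⟩
      exact ⟨hh i, ((hh i).cuts_iff C).2 ⟨_, hφ.mem _, _, hφ.mem _, adj_flipAt hφ ε i, hmem i⟩⟩
  rw [hrange, ← Set.image_univ, hinj.encard_image]
  simp

/-- The number of cutting hyperplanes is the dimension, so equal dimension turns the one-sided
inclusion in `Parallel` into equality of finite sets. -/
theorem parallel_iff {d : V → V → ℕ} (hd : X.IsCubicalDist d) {C D : X.Cube} :
    X.Parallel C D ↔ X.cutSet C = X.cutSet D := by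
  constructor
  · rintro ⟨⟨n, hC, hD⟩, h⟩
    have hC' := encard_cutSet hd hC
    have hD' := encard_cutSet hd hD
    refine Set.Finite.eq_of_subset_of_encard_le' ?_ (fun H hH => ⟨hH.1, h H hH.1 hH.2⟩) ?_
    · exact Set.finite_of_encard_eq_coe hD'
    · rw [hC', hD']
  · intro h
    obtain ⟨n, φ, hφ⟩ := X.exists_chart C.1 C.2
    obtain ⟨m, ψ, hψ⟩ := X.exists_chart D.1 D.2
    have h1 := encard_cutSet hd (C := C) ⟨φ, hφ⟩
    have h2 := encard_cutSet hd (C := D) ⟨ψ, hψ⟩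
    rw [h, h2] at h1
    obtain rfl : m = n := by exact_mod_cast h1
    exact ⟨⟨m, ⟨φ, hφ⟩, ψ, hψ⟩, fun H hH hcut => (h.subset ⟨hH, hcut⟩ : H ∈ X.cutSet D).2⟩

theorem parallel_equivalence {d : V → V → ℕ} (hd : X.IsCubicalDist d) : Equivalence X.Parallel where
  refl _ := (parallel_iff hd).2 rfl
  symm h := (parallel_iff hd).2 ((parallel_iff hd).1 h).symm
  trans h h' := (parallel_iff hd).2 (((parallel_iff hd).1 h).trans ((parallel_iff hd).1 h'))

/-- Opposite faces of a cube are parallel. -/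
theorem parallel_stdFace {d : V → V → ℕ} (hd : X.IsCubicalDist d) {n : ℕ}
    {φ : (Fin n → Bool) → V} {E : Set V} (hE : E ∈ X.cubes) (hφ : IsCubeChart X.cubes φ E)
    (s : Finset (Fin n)) (a b : Fin n → Bool) :
    X.Parallel (hφ.face s a) (hφ.face s b) := by
  classical
  suffices h : ∀ a b : Fin n → Bool, X.cutSet (hφ.face s a) ⊆
      X.cutSet (hφ.face s b) from
    (parallel_iff hd).2 ((h a b).antisymm (h b a))
  rintro a b H ⟨hH, hcut⟩
  refine ⟨hH, ?_⟩
  rw [hH.cuts_iff] at hcut ⊢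
  obtain ⟨u, ⟨ε, hε, rfl⟩, v, ⟨ε', hε', rfl⟩, hadj, huv⟩ := hcut
  obtain ⟨i, hi⟩ := exists_eq_flipAt hφ (hφ.mem ε') hadj
  obtain rfl := hφ.1 hi
  have his : i ∉ s := fun his => by
    have h1 := hε i his
    have h2 := hε' i his
    rw [flipAt_same, h1] at h2
    simp at h2
  set δ : Fin n → Bool := fun k => if k ∈ s then b k else ε k
  have hδ : ∀ k ∈ s, δ k = b k := fun k hk => if_pos hk
  refine ⟨φ δ, hφ.mem_image_iff.2 hδ, φ (flipAt δ i), hφ.mem_image_iff.2 fun k hk => ?_,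
    adj_flipAt hφ δ i, hH.flipAt_mem hφ hE δ huv⟩
  rw [flipAt_of_ne _ (by rintro rfl; exact his hk), hδ k hk]

end CubeComplex

/-! ### Descending cubes and normal cube paths -/

namespace CubeComplex

variable {V : Type*} {X : CubeComplex V} {d : V → V → ℕ} {P : V}

namespace IsCubicalDist

theorem adj_of_lt (hd : X.IsCubicalDist d) {v w : V} (h : X.Adj v w) (hlt : d w P < d v P) :
    d v P = d w P + 1 := by
  have := hd.adj P h
  omega

/-- The neighbours of a vertex that are closer to `P` span a cube. -/
theorem exists_descendingCube [Finite V] (hd : X.IsCubicalDist d) (hflag : ∀ v, X.IsFlagLink v)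
    (P Q : V) : ∃ C : X.Cube, Q ∈ C.1 ∧ ∀ w, X.Adj Q w → (w ∈ C.1 ↔ d w P < d Q P) := by
  obtain ⟨C, hC, hQ, hS⟩ := hflag Q {w | X.Adj Q w ∧ d w P < d Q P} (Set.toFinite _)
    (fun w hw => hw.1) fun a ha b hb hab => by
      obtain ⟨c, hs, -⟩ := hd.exists_square hab ha.1 hb.1 (hd.adj_of_lt ha.1 ha.2)
        (hd.adj_of_lt hb.1 hb.2)
      exact hs.isLinkSimplex
  refine ⟨⟨C, hC⟩, hQ, fun w hw => ?_⟩
  have := Set.ext_iff.1 hS w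
  simp only [Set.mem_ofPred_eq, hw, true_and, and_true] at this
  exact this.symm

/-- A vertex of a cube all of whose neighbours in the cube are farther from `P` is the closest
one to `P`. -/
theorem le_of_forall_lt_flipAt (hd : X.IsCubicalDist d) {n : ℕ} {φ : (Fin n → Bool) → V}
    {C : Set V} (hφ : IsCubeChart X.cubes φ C) {ε : Fin n → Bool}
    (h : ∀ i, d (φ ε) P < d (φ (flipAt ε i)) P) (δ : Fin n → Bool) : d (φ ε) P ≤ d (φ δ) P := by
  obtain ⟨δ₀, hδ₀⟩ := Finite.exists_min fun δ => d (φ δ) P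
  by_cases he : δ₀ = ε
  · exact he ▸ hδ₀ δ
  obtain ⟨i, hi⟩ := Function.ne_iff.1 he
  have h1 := hd.flipAt_lt hφ (ε := flipAt ε i) (δ := δ₀) (i := i) (x := P)
    (by rw [flipAt_same]; exact Bool.eq_not.mpr hi) (by rw [flipAt_flipAt]; exact h i)
  exact absurd (hδ₀ (flipAt δ₀ i)) (not_le.2 h1)

theorem flipAt_not_lt (hd : X.IsCubicalDist d) {n : ℕ} {φ : (Fin n → Bool) → V}
    {C : Set V} (hφ : IsCubeChart X.cubes φ C) {ε : Fin n → Bool} {i : Fin n}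
    (h : d (φ ε) P < d (φ (flipAt ε i)) P) :
    d (φ (flipAt (fun j => !ε j) i)) P < d (φ fun j => !ε j) P := by
  have := hd.lt_flipAt hφ (ε := ε) (δ := flipAt (fun j => !ε j) i) (i := i) (x := P)
    (by rw [flipAt_same]; simp) h
  rwa [flipAt_flipAt] at this

theorem not_flipAt_lt (hd : X.IsCubicalDist d) {n : ℕ} {φ : (Fin n → Bool) → V}
    {C : Set V} (hφ : IsCubeChart X.cubes φ C) {ε : Fin n → Bool} {i : Fin n}
    (h : d (φ (flipAt ε i)) P < d (φ ε) P) :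
    d (φ fun j => !ε j) P < d (φ (flipAt (fun j => !ε j) i)) P := by
  have := hd.flipAt_lt hφ (ε := ε) (δ := flipAt (fun j => !ε j) i) (i := i) (x := P)
    (by rw [flipAt_same]; simp) h
  rwa [flipAt_flipAt] at this

/-- A vertex of a cube has only one diagonally opposite vertex. -/
theorem isOpposite_unique (hd : X.IsCubicalDist d) {C : X.Cube} {u v v' : V}
    (h : X.IsOpposite C u v) (h' : X.IsOpposite C u v') : v = v' := by
  obtain ⟨n, φ, hφ, ε, rfl, rfl⟩ := h
  obtain ⟨m, ψ, hψ, ε', hε', rfl⟩ := h'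
  obtain ⟨δ, hδ⟩ := hφ.exists_eq (hψ.mem fun i => !ε' i)
  rw [← hδ]
  congr 1
  funext i
  by_contra hi
  have h1 := hd.lt_flipAt_of_eq hφ (ε := ε) (δ := δ) (i := i) (by
    by_contra h
    exact hi (Bool.eq_not.mpr h).symm)
  obtain ⟨k, hk⟩ := exists_eq_flipAt hψ (ε := ε') (hφ.mem (flipAt ε i))
    (by rw [← hε']; exact adj_flipAt hφ ε i)
  have h2 := hd.flipAt_lt_of_ne hψ (ε := ε') (δ := fun i => !ε' i) (i := k) (by simp)
  rw [← hδ, ← hk, ← hε'] at h2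
  exact absurd h1 h2.not_gt

end IsCubicalDist

section descendingCube

variable (X d P) in
/-- `D Q` is the cube spanned by the neighbours of `Q` that are closer to `P`. -/
def IsDescendingCube (D : V → X.Cube) : Prop :=
  ∀ Q, Q ∈ (D Q).1 ∧ ∀ w, X.Adj Q w → (w ∈ (D Q).1 ↔ d w P < d Q P)

variable {D : V → X.Cube}

theorem IsDescendingCube.self_eq (hd : X.IsCubicalDist d) (hD : X.IsDescendingCube d P D) :
    D P = X.vertexCube P := by
  refine Subtype.ext (Set.Subset.antisymm ?_ (Set.singleton_subset_iff.2 (hD P).1))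
  refine subset_of_forall_adj (D P).2 (X.singleton_mem P) (hD P).1 rfl fun w hw hadj => ?_
  have := ((hD P).2 w hadj).1 hw
  rw [(hd.eq_zero_iff P P).2 rfl] at this
  omega

/-- The first cube of a normal cube path to `P` is spanned by the edges leading closer to `P`. -/
theorem IsNormalCubePath.firstCube_eq (hd : X.IsCubicalDist d) (hD : X.IsDescendingCube d P D)
    {Q : V} {L : List X.Cube} (h : X.IsNormalCubePath Q P L) : X.firstCube Q L = D Q := by
  induction h with
  | refl v => exact (hD.self_eq hd).symm
  | @cons u v w C L hopp huv hL hstar ih =>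
    have ih := ih hD
    obtain ⟨n, φ, hφ, ε, rfl, rfl⟩ := hopp
    -- In a cube containing `C`, every edge at the end vertex of `C` leads away from the target: a
    -- descending one would lie in the next cube of the path, which meets the star of `C` only in
    -- that vertex.
    have key : ∀ E : X.Cube, C.1 ⊆ E.1 → ∀ b ∈ E.1, X.Adj (φ fun i => !ε i) b →
        d (φ fun i => !ε i) w < d b w := by
      intro E hE b hb hadj
      by_contra hlt
      have hlt' : d b w < d (φ fun i => !ε i) w := by
        have := hd.adj w hadj
        omega
      have hbD := ((hD _).2 b hadj).2 hlt'
      cases hL with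
      | refl => rw [(hd.eq_zero_iff _ _).2 rfl] at hlt'; omega
      | @cons _ _ _ C' L' =>
        rw [← ih] at hbD
        have hbE : b ∈ E.1 ∩ C'.1 := ⟨hb, hbD⟩
        rw [hstar C' (by simp) E hE] at hbE
        exact hadj.1 (Set.mem_singleton_iff.1 hbE).symm
    have hasc : ∀ i, d (φ fun i => !ε i) w < d (φ (flipAt (fun i => !ε i) i)) w := fun i =>
      key C subset_rfl _ (hφ.mem _) (adj_flipAt hφ _ i)
    have hdesc : ∀ i, d (φ (flipAt ε i)) w < d (φ ε) w := fun i => by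
      simpa using hd.flipAt_not_lt hφ (hasc i)
    have hsub : C.1 ⊆ (D (φ ε)).1 := by
      refine subset_of_forall_adj C.2 (D _).2 (hφ.mem ε) (hD _).1 fun a ha hadj => ?_
      obtain ⟨i, rfl⟩ := exists_eq_flipAt hφ ha hadj
      exact ((hD _).2 _ hadj).2 (hdesc i)
    show C = D (φ ε)
    -- An edge of the descending cube outside `C` has a parallel copy at the opposite vertex of `C`.
    -- That copy also descends, contradicting `key` for the descending cube itself.
    by_contra hne
    obtain ⟨a, haD, hadj, haC⟩ := exists_mem_adj (D _).2 C.2 hsub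
      (fun he => hne (Subtype.ext he)) (hφ.mem ε)
    obtain ⟨m, ψ, hψ⟩ := X.exists_chart _ (D (φ ε)).2
    obtain ⟨s, α, hs⟩ := (hψ.2.2 _ hsub).1 C.2
    obtain ⟨ε', hε'⟩ := hψ.exists_eq (hD (φ ε)).1
    obtain ⟨δ', hδ'⟩ := hψ.exists_eq (hsub (hφ.mem fun i => !ε i))
    have hda := ((hD _).2 a hadj).1 haD
    rw [← hε'] at hadj
    obtain ⟨i, rfl⟩ := exists_eq_flipAt hψ haD hadj
    have h1 : ∀ k ∈ s, ε' k = α k := hψ.mem_image_iff.1 (by rw [← hs, hε']; exact hφ.mem _)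
    have h2 : ∀ k ∈ s, δ' k = α k := hψ.mem_image_iff.1 (by rw [← hs, hδ']; exact hφ.mem _)
    have his : i ∈ s := by
      by_contra his
      refine haC ?_
      rw [hs]
      refine hψ.mem_image_iff.2 fun k hk => ?_
      rw [flipAt_of_ne _ (by rintro rfl; exact his hk), h1 k hk]
    have h3 := hd.flipAt_lt hψ (ε := ε') (δ := δ') (i := i) (x := w)
      ((h2 i his).trans (h1 i his).symm) (by rw [hε']; exact hda)
    have h4 := key (D (φ ε)) hsub (ψ (flipAt δ' i)) (hψ.mem _)
      (by rw [← hδ']; exact adj_flipAt hψ δ' i)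
    rw [← hδ'] at h4
    exact absurd h3 h4.not_gt

/-- The starting vertex determines the first cube, and that cube determines the next vertex. A
nonempty path cannot return from `P` to `P`, since its first cube would be the vertex `P`. -/
theorem IsNormalCubePath.eq_of_isDescendingCube (hd : X.IsCubicalDist d)
    (hD : X.IsDescendingCube d P D) {Q : V} {L L' : List X.Cube} (h : X.IsNormalCubePath Q P L)
    (h' : X.IsNormalCubePath Q P L') : L = L' := by
  have hnil : ∀ {C : X.Cube} {L : List X.Cube}, ¬ X.IsNormalCubePath P P (C :: L) := by
    intro C L h
    have h1 := h.firstCube_eq hd hD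
    rw [hD.self_eq hd] at h1
    change C = _ at h1
    cases h with
    | cons hopp hne _ _ =>
      obtain ⟨n, φ, hφ, ε, rfl, rfl⟩ := hopp
      have h2 := hφ.mem fun i => !ε i
      rw [h1] at h2
      exact hne (Set.mem_singleton_iff.1 h2).symm
  induction h generalizing L' with
  | refl v =>
    cases L' with
    | nil => rfl
    | cons C L' => exact absurd h' hnil
  | @cons u v w C L hopp huv hL hstar ih =>
    have h1 := (IsNormalCubePath.cons hopp huv hL hstar).firstCube_eq hd hD
    cases L' with
    | nil =>
      cases h'
      exact absurd (IsNormalCubePath.cons hopp huv hL hstar) hnil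
    | cons C' L' =>
      have h2 := h'.firstCube_eq hd hD
      obtain rfl : C = C' := h1.trans h2.symm
      cases h' with
      | cons hopp' _ hL' _ =>
        obtain rfl := hd.isOpposite_unique hopp hopp'
        rw [ih hD hL' hnil]

/-- The corner of `D Q` opposite `Q` is the vertex of that cube nearest to `P`, so the recursion on
the distance terminates. -/
theorem exists_isNormalCubePath (hd : X.IsCubicalDist d) (hD : X.IsDescendingCube d P D) (Q : V) :
    ∃ L, X.IsNormalCubePath Q P L := by
  induction hk : d Q P using Nat.strong_induction_on generalizing Q with
  | _ k ih =>
    by_cases hQP : Q = P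
    · exact ⟨[], hQP ▸ .refl Q⟩
    obtain ⟨a, hQa, ha⟩ := hd.exists_adj hQP
    obtain ⟨n, φ, hφ⟩ := X.exists_chart _ (D Q).2
    obtain ⟨ε, rfl⟩ := hφ.exists_eq (hD Q).1
    have hasc : ∀ i, d (φ fun i => !ε i) P < d (φ (flipAt (fun i => !ε i) i)) P := fun i =>
      hd.not_flipAt_lt hφ (((hD _).2 _ (adj_flipAt hφ ε i)).1 (hφ.mem _))
    have haD : a ∈ (D (φ ε)).1 := ((hD _).2 a hQa).2 (by omega)
    obtain ⟨j, rfl⟩ := exists_eq_flipAt hφ haD hQa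
    have hle := hd.le_of_forall_lt_flipAt hφ hasc (flipAt ε j)
    obtain ⟨L, hL⟩ := ih _ (by omega) (φ fun i => !ε i) rfl
    refine ⟨D (φ ε) :: L, .cons ⟨n, φ, hφ, ε, rfl, rfl⟩ (fun he => ?_) hL fun C' hC' E hE => ?_⟩
    · have := congrFun (hφ.1 he) j
      simp at this
    have hC'D : C' = D (φ fun i => !ε i) := by
      rw [← hL.firstCube_eq hd hD]
      cases L with
      | nil => simp at hC'
      | cons C'' L => exact (Option.some.inj hC').symm
    subst hC'D
    have hvE : (φ fun i => !ε i) ∈ E.1 := hE (hφ.mem _)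
    have hv : (φ fun i => !ε i) ∈ E.1 ∩ (D (φ fun i => !ε i)).1 := ⟨hvE, (hD _).1⟩
    refine Set.Subset.antisymm ?_ (Set.singleton_subset_iff.2 hv)
    refine subset_of_forall_adj (X.inter_mem _ E.2 _ (D _).2 ⟨_, hv⟩) (X.singleton_mem _) hv rfl
      fun b hb hadj => ?_
    exfalso
    have hdb := ((hD _).2 b hadj).1 hb.2
    obtain ⟨m, ψ, hψ⟩ := X.exists_chart _ E.2
    obtain ⟨s, α, hs⟩ := (hψ.2.2 _ hE).1 (D (φ ε)).2
    obtain ⟨δ, hδ⟩ := hψ.exists_eq hvE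
    obtain ⟨ε', hε'⟩ := hψ.exists_eq (hE (hφ.mem ε))
    obtain ⟨i, rfl⟩ := exists_eq_flipAt hψ (ε := δ) hb.1 (by rwa [hδ])
    have h1 : ∀ k ∈ s, ε' k = α k := hψ.mem_image_iff.1 (by rw [← hs, hε']; exact hφ.mem _)
    have h2 : ∀ k ∈ s, δ k = α k := hψ.mem_image_iff.1 (by rw [← hs, hδ]; exact hφ.mem _)
    -- The edge towards `b` descends. If it is transverse to the descending cube at `φ ε`, its
    -- parallel copy at `φ ε` descends too and would belong to that cube; if it lies in that cube,
    -- it leaves the vertex nearest to `P`.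
    by_cases his : i ∈ s
    · have h3 := hd.flipAt_lt hψ (ε := δ) (δ := ε') (i := i) (x := P)
        ((h1 i his).trans (h2 i his).symm) (by rw [hδ]; exact hdb)
      have hadj' := adj_flipAt hψ ε' i
      rw [hε'] at h3 hadj'
      have h4 := ((hD _).2 _ hadj').2 h3
      rw [hs] at h4
      have h5 := hψ.mem_image_iff.1 h4 i his
      rw [flipAt_same, h1 i his] at h5
      simp at h5
    · have hbD : ψ (flipAt δ i) ∈ (D (φ ε)).1 := by
        rw [hs]
        refine hψ.mem_image_iff.2 fun k hk => ?_
        rw [flipAt_of_ne _ (by rintro rfl; exact his hk), h2 k hk]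
      obtain ⟨l, hl⟩ := exists_eq_flipAt hφ hbD hadj
      have := hasc l
      rw [← hl] at this
      exact absurd hdb this.not_gt

/-- Vertices with parallel descending cubes coincide. -/
theorem IsDescendingCube.eq_of_parallel (hd : X.IsCubicalDist d) (hD : X.IsDescendingCube d P D)
    {Q Q' : V} (h : X.Parallel (D Q) (D Q')) : Q = Q' := by
  have key : ∀ {Q Q' : V}, X.Parallel (D Q') (D Q) → d Q P = d Q' Q + d Q' P := by
    intro Q Q' h
    refine hd.eq_add fun a hadj h1 h2 => ?_
    obtain ⟨H, hH, haH⟩ := IsHyperplane.exists_mem _ _ hadj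
    have hcut : X.Cuts H (D Q') := (hH.cuts_iff _).2
      ⟨Q', (hD Q').1, a, ((hD Q').2 a hadj).2 (by omega), hadj, haH⟩
    obtain ⟨b, hb, hadj', hbH⟩ := hH.exists_adj_mem (h.2 H hH hcut) (hD Q).1
    have hdb := ((hD Q).2 b hadj').1 hb
    -- The hyperplane of the edge from `Q'` to `a` also contains a descending edge at `Q`, which
    -- separates `Q` from `P`. So the first edge separates them as well, although `a` is nearer to
    -- both.
    have hsep : Separates d s(Q, b) Q P := by
      refine separates_mk.2 (.inl ⟨?_, hdb⟩)
      rw [(hd.eq_zero_iff Q Q).2 rfl]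
      exact Nat.pos_of_ne_zero fun h => hadj'.1 ((hd.eq_zero_iff b Q).1 h).symm
    have := hH.separates hd hbH haH hsep
    rw [separates_mk] at this
    omega
  have h1 := key h
  have h2 := key ((parallel_equivalence hd).symm h)
  exact (hd.eq_zero_iff Q Q').1 (by omega)

/-- Every cube is parallel to the descending cube of some vertex. -/
theorem IsDescendingCube.exists_parallel (hd : X.IsCubicalDist d) (hD : X.IsDescendingCube d P D)
    (C : X.Cube) : ∃ Q, X.Parallel (D Q) C := by
  suffices H : ∀ (k : ℕ) (C : X.Cube) (Q : V), Q ∈ C.1 →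
      (∀ w ∈ C.1, X.Adj Q w → d w P < d Q P) → d Q P = k → ∃ Q, X.Parallel (D Q) C by
    obtain ⟨n, φ, hφ⟩ := X.exists_chart C.1 C.2
    obtain ⟨ε, hε⟩ := Finite.exists_max fun δ => d (φ δ) P
    refine H _ C (φ ε) (hφ.mem ε) (fun w hw hadj => ?_) rfl
    have h1 := hd.adj P hadj
    obtain ⟨δ, rfl⟩ := hφ.exists_eq hw
    have h2 := hε δ
    omega
  intro k
  induction k using Nat.strong_induction_on with
  | _ k ih =>
    intro C Q hQ hC hk
    have hsub : C.1 ⊆ (D Q).1 := subset_of_forall_adj C.2 (D Q).2 hQ (hD Q).1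
      fun w hw hadj => ((hD Q).2 w hadj).2 (hC w hw hadj)
    by_cases he : C.1 = (D Q).1
    · exact ⟨Q, by rw [show D Q = C from Subtype.ext he.symm]; exact (parallel_equivalence hd).refl C⟩
    obtain ⟨a, haD, hadj, haC⟩ := exists_mem_adj (D Q).2 C.2 hsub he hQ
    obtain ⟨n, ψ, hψ⟩ := X.exists_chart _ (D Q).2
    obtain ⟨s, α, hs⟩ := (hψ.2.2 _ hsub).1 C.2
    obtain ⟨ε, rfl⟩ := hψ.exists_eq (hD Q).1
    obtain ⟨i, rfl⟩ := exists_eq_flipAt hψ haD hadj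
    have h1 : ∀ k ∈ s, ε k = α k := hψ.mem_image_iff.1 (by rwa [← hs])
    have hdesc : ∀ j, d (ψ (flipAt ε j)) P < d (ψ ε) P := fun j =>
      ((hD _).2 _ (adj_flipAt hψ ε j)).1 (hψ.mem _)
    have h2 : ∀ k ∈ s, flipAt ε i k = flipAt α i k := fun k hk => by
      by_cases hki : k = i
      · subst hki; rw [flipAt_same, flipAt_same, h1 k hk]
      · rw [flipAt_of_ne _ hki, flipAt_of_ne _ hki, h1 k hk]
    have his : i ∈ s := by
      by_contra his
      refine haC ?_
      rw [hs]
      refine hψ.mem_image_iff.2 fun k hk => ?_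
      rw [flipAt_of_ne _ (by rintro rfl; exact his hk), h1 k hk]
    have hpar : X.Parallel (hψ.face s (flipAt α i)) C := by
      rw [show C = hψ.face s α from Subtype.ext hs]
      exact parallel_stdFace hd (D _).2 hψ s _ _
    -- The opposite face across direction `i` is parallel to `C`, and its farthest vertex from `P`
    -- is the flip of `ε` at `i`, which is nearer to `P` than the old one.
    obtain ⟨Q', hQ'⟩ := ih _ (hk ▸ hdesc i) (hψ.face s (flipAt α i)) (ψ (flipAt ε i))
      (hψ.mem_image_iff.2 h2) (fun w hw hadj' => by
        obtain ⟨δ, hδ, rfl⟩ := hw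
        obtain ⟨j, hj⟩ := exists_eq_flipAt hψ (hψ.mem δ) hadj'
        obtain rfl := hψ.1 hj
        have hji : j ≠ i := by
          rintro rfl
          have := hδ j his
          rw [flipAt_same, h2 j his] at this
          simp at this
        exact hd.flipAt_lt hψ (flipAt_of_ne _ hji) (hdesc j)) rfl
    exact ⟨Q', (parallel_equivalence hd).trans hQ' hpar⟩

end descendingCube

end CubeComplex

/-! ### The main theorem -/

theorem mainTheorem3 {V : Type*} [Finite V] (X : CubeComplex V) (hX : X.IsCAT0) :
    Equivalence X.Parallel ∧
    Nat.card V = Nat.card X.ParallelClass ∧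
    ∀ P : V,
      (∀ Q : V, ∃! L : List X.Cube, X.IsNormalCubePath Q P L) ∧
      ∃ f : V → X.ParallelClass, Function.Bijective f ∧
        ∀ (Q : V) (L : List X.Cube), X.IsNormalCubePath Q P L →
          f Q = Quot.mk X.Parallel (X.firstCube Q L) := by
  have := hX.simplyConnected
  obtain ⟨d, hd⟩ := CubeComplex.exists_isCubicalDist hX.flag
  have hpar := CubeComplex.parallel_equivalence hd
  have main : ∀ P : V, (∀ Q : V, ∃! L : List X.Cube, X.IsNormalCubePath Q P L) ∧
      ∃ f : V → X.ParallelClass, Function.Bijective f ∧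
        ∀ (Q : V) (L : List X.Cube), X.IsNormalCubePath Q P L →
          f Q = Quot.mk X.Parallel (X.firstCube Q L) := by
    intro P
    choose D hD using hd.exists_descendingCube hX.flag P
    have hD : X.IsDescendingCube d P D := hD
    refine ⟨fun Q => ?_, fun Q => Quot.mk _ (D Q), ⟨fun Q Q' h => ?_, fun c => ?_⟩,
      fun Q L hL => ?_⟩
    · obtain ⟨L, hL⟩ := CubeComplex.exists_isNormalCubePath hd hD Q
      exact ⟨L, hL, fun L' hL' => hL'.eq_of_isDescendingCube hd hD hL⟩
    · exact hD.eq_of_parallel hd ((hpar.quot_mk_eq_iff _ _).1 h)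
    · obtain ⟨C, rfl⟩ := Quot.exists_rep c
      obtain ⟨Q, hQ⟩ := hD.exists_parallel hd C
      exact ⟨Q, Quot.sound hQ⟩
    · rw [hL.firstCube_eq hd hD]
  refine ⟨hpar, ?_, main⟩
  -- The count needs some base vertex; simple connectivity makes the realization nonempty, and a
  -- point of it has a vertex in its support.
  obtain ⟨p⟩ : Nonempty X.realization := inferInstance
  obtain ⟨-, -, -, P, -⟩ := CubeComplex.exists_support p.2
  obtain ⟨f, hf, -⟩ := (main P).2
  exact Nat.card_congr (Equiv.ofBijective f hf)
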